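/- **Setting (Bandits with Knapsacks).** There are $K$ arms, $d$ resources, $T\ge 1$ rounds and a common budget $B>0$. Pulling arm $a$ yields an outcome $(r;c_1,\dots,c_d)\in[0,1]^{d+1}$ (reward and consumption of each resource), drawn independently of the past from a distribution $\mathcal D_a$, with means $r(a)$, $c_j(a)$. One resource, "time", is consumed deterministically, $B/T$ units per round by every arm; one arm, "null", has reward $0$ and consumption $0$ of all other resources. The process stops after the first round in which the total consumption of some resource exceeds $B$, or after $T$ rounds. $\mathrm{OPT}_{DP}$ is the supremum, over all (randomized, history-dependent) algorithms, of the expected total reward collected. For a distribution $X$ over arms, $r(X)=\sum_a X(a)r(a)$. Write $L=\log(KTd)$ and $$\eta_{LP}=3\Big(\sqrt{\tfrac KB L}+\tfrac KB L^2\Big).$$ **Algorithm UcbBwK (with parameter $\gamma$).** Let $C_{\rm rad}=\gamma L$ and $f_{\rm rad}(\mu,N)=\min\big(1,\sqrt{C_{\rm rad}\,\mu/\max(1,N)}+C_{\rm rad}/\max(1,N)\big)$. In round $t$, let $N_t(a)$ be the number of previous pulls of arm $a$, and $\hat r_t(a)$, $\hat c_{j,t}(a)$ the sample averages of its rewards and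 consumptions ($0$ if $N_t(a)=0$). With $\mathrm{proj}$ the projection onto $[0,1]$, put, for $a\ne$ null and $j\ne$ time, $$r_t^+(a)=\mathrm{proj}\big(\hat r_t(a)+f_{\rm rad}(\hat r_t(a),N_t(a))\big),\qquad c^-_{j,t}(a)=\mathrm{proj}\big(\hat c_{j,t}(a)-f_{\rm rad}(\hat c_{j,t}(a),N_t(a))\big),$$ and $r_t^+(\text{null})=c^-_{j,t}(\text{null})=0$. The algorithm computes an optimal solution $X_t$ (with any tie-breaking) of: maximize $\sum_a X(a)r^+_t(a)$ over distributions $X$ over arms with $\sum_a X(a)c^-_{j,t}(a)\le (1-\eta_{LP})B/T$ for every resource $j\neq$ time; it then pulls an arm $a_t$ sampled from $X_t$. **Theorem.** For all constants $\beta>0$, $M>0$ and $\gamma\ge 8$ there is a constant $C$, depending only on $\beta,M,\gamma$, such that the following holds for every problem instance with $B\ge\beta T$ and $\eta_{LP}\le\frac12$. If UcbBwK with parameter $\gamma$ is run for $T$ rounds, then with probability at least $1-C\,T^{-3}$, simultaneously for all $\varepsilon>0$ such that $\varepsilon\ge 2\eta_{LP}$ or $K L^3\le M B$, the number of rounds $t\in\{1,\dots,T\}$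 whose simple regret satisfies $\mathrm{OPT}_{DP}/T-r(X_t)\ge\varepsilon$ is at most $$C\,\frac{K}{\varepsilon^2}\,\log(KTd).$$ In particular, if $K\log^3(KTd)\le M B$, this holds simultaneously for all $\varepsilon>0$. -/

import Mathlib

open MeasureTheory ProbabilityTheory

namespace BwK

/-- The outcome of one round: a reward, and the consumption of each of the `d` resources. -/
abbrev Outcome (d : ℕ) : Type := ℝ × (Fin d → ℝ)

/-- What is recorded in one round: the chosen arm and the observed outcome. -/
abbrev Round (K d : ℕ) : Type := Fin K × Outcome d

/-- A history of `t` rounds. -/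
abbrev History (K d t : ℕ) : Type := Fin t → Round K d

/-- An instance of (stochastic) Bandits with Knapsacks with `K` arms and `d` resources.
All resources have the same budget `B`; one resource is time, of which each arm
deterministically consumes `B / T` in each round; one arm is the null arm. -/
structure Instance (K d : ℕ) where
  /-- the time horizon -/
  T : ℕ
  T_pos : 0 < T
  /-- the common budget -/
  B : ℝ
  B_pos : 0 < B
  /-- the distribution over outcomes of each arm -/
  dist : Fin K → Measure (Outcome d)
  dist_prob : ∀ a, IsProbabilityMeasure (dist a)
  reward_mem : ∀ a, ∀ᵐ o ∂(dist a), o.1 ∈ Set.Icc (0 : ℝ) 1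
  cons_mem : ∀ a, ∀ᵐ o ∂(dist a), ∀ j, o.2 j ∈ Set.Icc (0 : ℝ) 1
  /-- the time resource -/
  time : Fin d
  cons_time : ∀ a, ∀ᵐ o ∂(dist a), o.2 time = B / T
  /-- the null arm -/
  null : Fin K
  reward_null : ∀ᵐ o ∂(dist null), o.1 = 0
  cons_null : ∀ᵐ o ∂(dist null), ∀ j, j ≠ time → o.2 j = 0

/-- An algorithm: in each round it chooses a distribution over arms, given the history of
the previous rounds (measurably), and samples the arm from it. -/
structure Policy (K d : ℕ) where
  kernel : (t : ℕ) → Kernel (History K d t) (Fin K)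
  markov : ∀ t, IsMarkovKernel (kernel t)

/-- The distribution `X_t` over arms that the algorithm chooses after a history, as a vector. -/
noncomputable def Policy.choice {K d : ℕ} (π : Policy K d) {t : ℕ} (h : History K d t) :
    Fin K → ℝ :=
  fun a => (π.kernel t h).real {a}

namespace Instance

variable {K d : ℕ} (I : Instance K d)

/-- The distributions over outcomes, as a kernel from arms to outcomes. -/
noncomputable def outcomeKernel : Kernel (Fin K) (Outcome d) where
  toFun := I.dist
  measurable' := Measurable.of_discrete

/-- One round: the arm is drawn from the chosen distribution over arms, then the outcome from
the distribution of that arm, independently of the past. -/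
noncomputable def stepKernel (π : Policy K d) (t : ℕ) : Kernel (History K d t) (Round K d) :=
  π.kernel t ⊗ₖ Kernel.prodMkLeft (History K d t) I.outcomeKernel

/-- The law of the first `t` rounds when the algorithm `π` is run on the instance. -/
noncomputable def law (π : Policy K d) : (t : ℕ) → Measure (History K d t)
  | 0 => Measure.dirac Fin.elim0
  | t + 1 => (law π t ⊗ₘ I.stepKernel π t).map
      (fun p => (Fin.snoc p.1 p.2 : History K d (t + 1)))

/-- Appending a round to a history is measurable. -/
theorem measurable_snoc (t : ℕ) :
    Measurable (fun p : History K d t × Round K d => (Fin.snoc p.1 p.2 : History K d (t + 1))) := by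
  refine measurable_pi_lambda _ fun i => ?_
  refine Fin.lastCases ?_ (fun j => ?_) i
  · simpa using measurable_snd
  · simp only [Fin.snoc_castSucc]
    exact (measurable_pi_apply j).comp measurable_fst

theorem isMarkov_stepKernel (π : Policy K d) (t : ℕ) : IsMarkovKernel (I.stepKernel π t) := by
  have := π.markov t
  have : IsMarkovKernel I.outcomeKernel := ⟨I.dist_prob⟩
  unfold stepKernel
  infer_instance

/-- The law of the history is a probability measure. -/
theorem isProb_law (π : Policy K d) (t : ℕ) : IsProbabilityMeasure (I.law π t) := by
  induction t with
  | zero => unfold law; infer_instance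
  | succ t ih =>
    have := I.isMarkov_stepKernel π t
    unfold law
    exact Measure.isProbabilityMeasure_map (measurable_snoc t).aemeasurable

/-- The history before round `t` (rounds are numbered from `0`), in a full run of `T` rounds. -/
def before (ω : History K d I.T) (t : Fin I.T) : History K d t :=
  fun s => ω (Fin.castLE t.isLt.le s)

open Classical in
/-- The total reward: round `t` is played if and only if no resource has exceeded its budget in
the previous rounds; so the algorithm stops after the round in which some budget is exceeded, or
after `T` rounds. -/
noncomputable def totalReward (ω : History K d I.T) : ℝ :=
  ∑ t : Fin I.T, if ∀ j, ∑ s, (I.before ω t s).2.2 j ≤ I.B then (ω t).2.1 else 0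

/-- The expected total reward of an algorithm. -/
noncomputable def expReward (π : Policy K d) : ℝ := ∫ ω, I.totalReward ω ∂(I.law π I.T)

/-- The best dynamic policy benchmark: the largest (supremum of the) expected total reward over
all algorithms. -/
noncomputable def OPTDP : ℝ := ⨆ π : Policy K d, I.expReward π

/-- The mean reward of an arm. -/
noncomputable def meanReward (a : Fin K) : ℝ := ∫ o, o.1 ∂(I.dist a)

/-- The simple regret of a distribution `X` over arms. -/
noncomputable def simpleRegret (X : Fin K → ℝ) : ℝ :=
  I.OPTDP / I.T - ∑ a, X a * I.meanReward a

/-- `log (K T d)`. -/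
noncomputable def logKTd : ℝ := Real.log ((K : ℝ) * I.T * d)

/-- The rescaling parameter. -/
noncomputable def etaLP : ℝ :=
  3 * (√(K / I.B * I.logKTd) + K / I.B * I.logKTd ^ 2)

end Instance

section Empirical

variable {K d t : ℕ}

/-- The number of rounds of the history in which arm `a` has been chosen. -/
def numPulls (h : History K d t) (a : Fin K) : ℕ := ∑ s, if (h s).1 = a then 1 else 0

/-- The sample average of the rewards of arm `a` (`0` if there are no samples). -/
noncomputable def avgReward (h : History K d t) (a : Fin K) : ℝ :=
  (∑ s, if (h s).1 = a then (h s).2.1 else 0) / numPulls h a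

/-- The sample average of the consumption of resource `j` by arm `a` (`0` if there are no
samples). -/
noncomputable def avgCons (h : History K d t) (j : Fin d) (a : Fin K) : ℝ :=
  (∑ s, if (h s).1 = a then (h s).2.2 j else 0) / numPulls h a

end Empirical

/-- The confidence radius `f_rad (μ, N)`, with parameter `C = C_rad`. -/
noncomputable def fRad (C μ : ℝ) (N : ℕ) : ℝ :=
  min 1 (√(C * μ / max 1 N) + C / max 1 N)

/-- The projection to `[0,1]`. -/
noncomputable def proj (x : ℝ) : ℝ := max 0 (min 1 x)

namespace Instance

variable {K d : ℕ} (I : Instance K d) (γ : ℝ) {t : ℕ}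

/-- `C_rad = γ log (K d T)`. -/
noncomputable def Crad : ℝ := γ * I.logKTd

/-- The upper confidence bound `r_t^+(a)` on the mean reward. -/
noncomputable def ucbReward (h : History K d t) (a : Fin K) : ℝ :=
  if a = I.null then 0
  else proj (avgReward h a + fRad (I.Crad γ) (avgReward h a) (numPulls h a))

/-- The lower confidence bound `c_{j,t}^-(a)` on the mean consumption. -/
noncomputable def lcbCons (h : History K d t) (j : Fin d) (a : Fin K) : ℝ :=
  if j = I.time then I.B / I.T
  else if a = I.null then 0
  else proj (avgCons h j a - fRad (I.Crad γ) (avgCons h j a) (numPulls h a))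

/-- The feasible region of the optimistic linear program: the budget constraint is rescaled for
each resource other than time. -/
def optimisticFeasible (h : History K d t) : Set (Fin K → ℝ) :=
  {X | X ∈ stdSimplex ℝ (Fin K) ∧
    ∀ j, ∑ a, X a * I.lcbCons γ h j a ≤
      if j = I.time then I.B / I.T else I.B / I.T * (1 - I.etaLP)}

/-- `X` is an optimal solution of the optimistic linear program. -/
def IsOptimistic (h : History K d t) (X : Fin K → ℝ) : Prop :=
  X ∈ I.optimisticFeasible γ h ∧
    IsMaxOn (fun Y => ∑ a, Y a * I.ucbReward γ h a) (I.optimisticFeasible γ h) X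

/-- `π` is the algorithm UcbBwK, with some way to choose among optimal solutions of the optimistic
linear program: in each round, the arm is sampled from an optimal solution. -/
def IsUcbBwK (π : Policy K d) : Prop :=
  ∀ t < I.T, ∀ h : History K d t, I.IsOptimistic γ h (π.choice h)

end Instance

end BwK

/-! ### The law of a run: exponential supermartingales and marginals. -/

namespace BwK

open scoped ENNReal

variable {K d : ℕ}

/-! Optimism. The reward of any policy is determined by the expected numbers `p a` of pulls made
while no budget is exceeded. Their total is at most `T`, and they consume at most `B + 1` of each
resource, because only the last round played can overshoot (`exists_expected_pulls`). When the
confidence intervals hold, a scaled copy of `p`, with the missing mass on the null arm, is feasible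
for the optimistic program. Hence the simple regret of `X_t` is at most `etaLP + 1 / B` plus the
expected radius of an arm drawn from `X_t` (`simpleRegret_le_of_confident`). Since `1 / B ≤ etaLP /
12`, for `ε ≥ 2 * etaLP` a regret of at least `ε` forces an expected radius of at least `ε / 4`.

Counting. Let `s` be the number of rounds with expected radius at least `θ`, where `ε / 8 ≤ θ ≤ ε /
4`. An exponential supermartingale compares half of the expected radii in these rounds with the
radii of the arms really drawn; the loss is an additive multiple of `L`, with no fluctuation term of
order `√s` or `√T` (`law_radiusGap_tail_le`). The realized radii decay like `√(C / N)`, so by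
Cauchy–Schwarz over the arms they add up to at most `12 * √(C * K * s)` (`sum_selected_radius_le`).
Thus `s * θ ≤ 24 * √(C * K * s) + 8 * L`, and `s` is of order `K * L / ε ^ 2`.

Small `ε`. If `ε < 2 * etaLP`, the hypothesis `K * L ^ 3 ≤ M * B` gives `etaLP ^ 2 ≲ K * L / B ≲ K *
L / T`, and the claimed bound exceeds `T`.

Probability. The bad events are Chernoff deviations, one for each coordinate, arm, number of pulls
and side, and supermartingale deviations, one for each of `T` grid values of `θ`, which serve all
`ε` at once. There are at most `5 * K * T * d` of them, each of probability at most `(K * T * d) ^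
(-4)`. -/

/-- The history before round `t`. -/
def past {n : ℕ} (ω : History K d n) (t : Fin n) : History K d t :=
  fun s => ω (Fin.castLE t.isLt.le s)

theorem measurable_past {n : ℕ} (t : Fin n) :
    Measurable (fun ω : History K d n => past ω t) :=
  measurable_pi_lambda _ fun _ => measurable_pi_apply _

theorem past_snoc_castSucc {n : ℕ} (ω : History K d n) (r : Round K d) (t : Fin n) :
    past (Fin.snoc ω r : History K d (n + 1)) t.castSucc = past ω t := by
  funext s
  exact Fin.snoc_castSucc (α := fun _ => Round K d) r ω (Fin.castLE t.isLt.le s)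

theorem past_snoc_last {n : ℕ} (ω : History K d n) (r : Round K d) :
    past (Fin.snoc ω r : History K d (n + 1)) (Fin.last n) = ω := by
  funext s
  exact Fin.snoc_castSucc (α := fun _ => Round K d) r ω s

namespace Instance

variable (I : Instance K d) (π : Policy K d)

theorem lintegral_stepKernel {t : ℕ} (h : History K d t) {F : Round K d → ℝ≥0∞}
    (hF : Measurable F) :
    ∫⁻ r, F r ∂(I.stepKernel π t h) = ∑ a, π.kernel t h {a} * ∫⁻ o, F (a, o) ∂(I.dist a) := by
  have := π.markov t
  have : IsMarkovKernel I.outcomeKernel := ⟨I.dist_prob⟩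
  unfold stepKernel
  rw [Kernel.lintegral_compProd _ _ _ hF, lintegral_fintype]
  refine Finset.sum_congr rfl fun a _ => ?_
  rw [mul_comm, Kernel.prodMkLeft_apply]
  rfl

theorem sum_kernel_singleton {t : ℕ} (h : History K d t) : ∑ a, π.kernel t h {a} = 1 := by
  have := π.markov t
  rw [sum_measure_singleton]
  simp

theorem choice_nonneg {t : ℕ} (h : History K d t) (a : Fin K) : 0 ≤ π.choice h a :=
  measureReal_nonneg

theorem sum_choice {t : ℕ} (h : History K d t) : ∑ a, π.choice h a = 1 := by
  have := π.markov t
  unfold Policy.choice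
  rw [sum_measureReal_singleton]
  simp

theorem lintegral_stepKernel_le_one {t : ℕ} (h : History K d t) {F : Round K d → ℝ≥0∞}
    (hF : Measurable F) (hle : ∀ a, ∫⁻ o, F (a, o) ∂(I.dist a) ≤ 1) :
    ∫⁻ r, F r ∂(I.stepKernel π t h) ≤ 1 := by
  rw [I.lintegral_stepKernel π h hF, ← sum_kernel_singleton π h]
  exact Finset.sum_le_sum fun a _ => mul_le_of_le_one_right' (hle a)

/-- The partial products form a supermartingale: integrating out the last round first multiplies by
a factor at most 1. -/
theorem lintegral_prod_le_one (g : (t : ℕ) → History K d t × Round K d → ℝ≥0∞)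
    (hg : ∀ t, Measurable (g t))
    (hle : ∀ t h, ∫⁻ r, g t (h, r) ∂(I.stepKernel π t h) ≤ 1) (n : ℕ) :
    ∫⁻ ω, ∏ t : Fin n, g t (past ω t, ω t) ∂(I.law π n) ≤ 1 := by
  induction n with
  | zero =>
    have := I.isProb_law π 0
    simp
  | succ n ih =>
    have := I.isProb_law π n
    have := I.isMarkov_stepKernel π n
    have hm : Measurable (fun ω : History K d n => ∏ t : Fin n, g t (past ω t, ω t)) :=
      Finset.measurable_prod _ fun t _ =>
        (hg t).comp ((measurable_past t).prodMk (measurable_pi_apply t))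
    rw [law]
    refine (lintegral_map_le _ _).trans ?_
    simp only [Fin.prod_univ_castSucc, past_snoc_castSucc, past_snoc_last, Fin.snoc_castSucc,
      Fin.snoc_last, Fin.val_castSucc, Fin.val_last]
    have hm' : Measurable fun p : History K d n × Round K d =>
        (∏ t : Fin n, g t (past p.1 t, p.1 t)) * g n (p.1, p.2) :=
      (hm.comp measurable_fst).mul (hg n)
    rw [Measure.lintegral_compProd hm']
    refine le_trans (lintegral_mono fun ω => ?_) ih
    have hmr : Measurable fun r : Round K d => g n (ω, r) := (hg n).comp measurable_prodMk_left
    change ∫⁻ r, (∏ t : Fin n, g t (past ω t, ω t)) * g n (ω, r) ∂(I.stepKernel π n ω) ≤ _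
    rw [lintegral_const_mul _ hmr]
    exact mul_le_of_le_one_right' (hle n ω)

/-- Markov's inequality for the exponential supermartingale. Both concentration arguments, for
sample sums and for radii, are instances. -/
theorem law_sum_ge_le (f : (t : ℕ) → History K d t × Round K d → ℝ) (hf : ∀ t, Measurable (f t))
    (hle : ∀ t h, ∫⁻ r, ENNReal.ofReal (Real.exp (f t (h, r))) ∂(I.stepKernel π t h) ≤ 1)
    (n : ℕ) (x : ℝ) :
    I.law π n {ω | x ≤ ∑ t : Fin n, f t (past ω t, ω t)} ≤ ENNReal.ofReal (Real.exp (-x)) := by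
  have h1 := I.lintegral_prod_le_one π (fun t p => ENNReal.ofReal (Real.exp (f t p)))
    (fun t => ENNReal.measurable_ofReal.comp (Real.measurable_exp.comp (hf t))) hle n
  have hm : Measurable (fun ω : History K d n =>
      ∏ t : Fin n, ENNReal.ofReal (Real.exp (f t (past ω t, ω t)))) :=
    Finset.measurable_prod _ fun t _ => ENNReal.measurable_ofReal.comp (Real.measurable_exp.comp
      ((hf t).comp ((measurable_past t).prodMk (measurable_pi_apply t))))
  have h2 := mul_meas_ge_le_lintegral (μ := I.law π n) hm (ENNReal.ofReal (Real.exp x))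
  have h3 : {ω : History K d n | x ≤ ∑ t : Fin n, f t (past ω t, ω t)} ⊆
      {ω | ENNReal.ofReal (Real.exp x) ≤
        ∏ t : Fin n, ENNReal.ofReal (Real.exp (f t (past ω t, ω t)))} := by
    intro ω hω
    simp only [Set.mem_ofPred_eq] at hω ⊢
    rw [← ENNReal.ofReal_prod_of_nonneg fun _ _ => (Real.exp_pos _).le, ← Real.exp_sum]
    exact ENNReal.ofReal_le_ofReal (Real.exp_le_exp.2 hω)
  refine (measure_mono h3).trans ?_
  rw [Real.exp_neg, ENNReal.ofReal_inv_of_pos (Real.exp_pos _)]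
  refine (ENNReal.le_inv_iff_mul_le).2 ?_
  rw [mul_comm]
  exact h2.trans h1

theorem ae_law {P : Round K d → Prop} (hP : MeasurableSet {r | P r})
    (h : ∀ a, ∀ᵐ o ∂(I.dist a), P (a, o)) (n : ℕ) :
    ∀ᵐ ω ∂(I.law π n), ∀ t : Fin n, P (ω t) := by
  induction n with
  | zero => exact Filter.Eventually.of_forall fun ω t => t.elim0
  | succ n ih =>
    have := I.isProb_law π n
    have := I.isMarkov_stepKernel π n
    have hmeas : ∀ m, MeasurableSet {ω : History K d m | ∀ t, P (ω t)} := fun m => by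
      rw [Set.ofPred_forall]
      exact MeasurableSet.iInter fun t => measurable_pi_apply t hP
    rw [law, ae_map_iff (measurable_snoc n).aemeasurable (hmeas _)]
    have hstep : ∀ ω : History K d n, ∀ᵐ r ∂(I.stepKernel π n ω), P r := by
      intro ω
      rw [ae_iff]
      change I.stepKernel π n ω {r | P r}ᶜ = 0
      rw [← lintegral_indicator_one hP.compl,
        I.lintegral_stepKernel π ω (measurable_one.indicator hP.compl)]
      refine Finset.sum_eq_zero fun a _ => ?_
      rw [mul_eq_zero]
      right
      rw [lintegral_eq_zero_iff' ?_]
      · filter_upwards [h a] with o ho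
        simp [ho]
      · exact ((measurable_one.indicator hP.compl).comp measurable_prodMk_left).aemeasurable
    refine (Measure.ae_compProd_iff ?_).2 ?_
    · exact measurable_snoc n (hmeas _)
    · filter_upwards [ih] with ω hω
      filter_upwards [hstep ω] with r hr t
      refine Fin.lastCases ?_ (fun s => ?_) t
      · simpa using hr
      · simpa using hω s

theorem law_map_castLE {t n : ℕ} (htn : t ≤ n) :
    (I.law π n).map (fun ω s => ω (Fin.castLE htn s)) = I.law π t := by
  induction n, htn using Nat.le_induction with
  | base => exact Measure.map_id
  | succ n htn ih =>
    have := I.isProb_law π n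
    have := I.isMarkov_stepKernel π n
    have hm : Measurable (fun (ω : History K d n) (s : Fin t) => ω (Fin.castLE htn s)) :=
      measurable_pi_lambda _ fun _ => measurable_pi_apply _
    rw [law, Measure.map_map (measurable_pi_lambda _ fun _ => measurable_pi_apply _)
      (measurable_snoc n), ← ih]
    have : ((fun (ω : History K d (n + 1)) (s : Fin t) => ω (Fin.castLE (htn.trans n.le_succ) s)) ∘
        fun p : History K d n × Round K d => (Fin.snoc p.1 p.2 : History K d (n + 1)))
        = (fun (ω : History K d n) (s : Fin t) => ω (Fin.castLE htn s)) ∘ Prod.fst := by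
      funext p s
      exact Fin.snoc_castSucc (α := fun _ => Round K d) p.2 p.1 (Fin.castLE htn s)
    rw [this, ← Measure.map_map hm measurable_fst]
    congr 1
    exact Measure.fst_compProd _ _

theorem law_map_past {n : ℕ} (t : Fin n) :
    (I.law π n).map (fun ω => (past ω t, ω t)) = I.law π t ⊗ₘ I.stepKernel π t := by
  have h := I.law_map_castLE π (t := t + 1) t.isLt
  have hm : Measurable (fun ω : History K d (t + 1) =>
      (past ω (Fin.last t), ω (Fin.last t))) :=
    (measurable_past (Fin.last (t : ℕ))).prodMk (measurable_pi_apply _)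
  have h2 := congrArg (Measure.map
    (fun ω : History K d (t + 1) => (past ω (Fin.last t), ω (Fin.last t)))) h
  have hc : Measurable fun (ω : History K d n) (s : Fin (t + 1)) =>
      ω (Fin.castLE (Nat.succ_le_of_lt t.isLt) s) :=
    measurable_pi_lambda _ fun _ => measurable_pi_apply _
  rw [Measure.map_map hm hc, law,
    Measure.map_map hm (measurable_snoc _)] at h2
  refine Eq.trans ?_ (h2.trans ?_)
  · rfl
  · have hid : ((fun ω : History K d (t + 1) => (past ω (Fin.last t), ω (Fin.last t))) ∘
        fun p : History K d t × Round K d => (Fin.snoc p.1 p.2 : History K d (t + 1))) = id := by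
      funext p
      exact Prod.ext (past_snoc_last p.1 p.2) (Fin.snoc_last (α := fun _ => Round K d) p.2 p.1)
    rw [hid]
    exact Measure.map_id

end Instance

/-! ### Exponential moments and sums over the first pulls of an arm. -/

theorem exp_mul_le_of_mem_Icc (l : ℝ) {x : ℝ} (hx : x ∈ Set.Icc (0 : ℝ) 1) :
    Real.exp (l * x) ≤ 1 + x * (Real.exp l - 1) := by
  have h := convexOn_exp.2 (Set.mem_univ 0) (Set.mem_univ l) (sub_nonneg.2 hx.2) hx.1 (by ring)
  simp only [smul_eq_mul, mul_zero, zero_add, Real.exp_zero, mul_one] at h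
  rw [mul_comm l x]
  linarith

/-- The chord bound for `exp` on `[0,1]` depends on `φ` only through its mean, and `1 + y ≤ exp y`
absorbs the rest. This gives the Poisson-type moment bound behind the multiplicative Chernoff
inequality. -/
theorem lintegral_exp_centered_le_one {Ω : Type*} [MeasurableSpace Ω] (ν : Measure Ω)
    [IsProbabilityMeasure ν] {φ : Ω → ℝ} (hφ : Measurable φ)
    (h01 : ∀ᵐ o ∂ν, φ o ∈ Set.Icc (0 : ℝ) 1) (l : ℝ) :
    ∫⁻ o, ENNReal.ofReal (Real.exp (l * φ o - (∫ o, φ o ∂ν) * (Real.exp l - 1))) ∂ν ≤ 1 := by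
  set μ := ∫ o, φ o ∂ν with hμ
  have hint : Integrable φ ν := Integrable.of_mem_Icc 0 1 hφ.aemeasurable h01
  have hint2 : Integrable (fun o => (1 + φ o * (Real.exp l - 1)) *
      Real.exp (-(μ * (Real.exp l - 1)))) ν :=
    ((integrable_const 1).add (hint.mul_const _)).mul_const _
  calc _ ≤ ∫⁻ o, ENNReal.ofReal ((1 + φ o * (Real.exp l - 1)) *
        Real.exp (-(μ * (Real.exp l - 1)))) ∂ν := by
        refine lintegral_mono_ae ?_
        filter_upwards [h01] with o ho
        refine ENNReal.ofReal_le_ofReal ?_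
        rw [sub_eq_add_neg, Real.exp_add]
        exact mul_le_mul_of_nonneg_right (exp_mul_le_of_mem_Icc l ho) (Real.exp_pos _).le
    _ = ENNReal.ofReal ((1 + μ * (Real.exp l - 1)) * Real.exp (-(μ * (Real.exp l - 1)))) := by
        rw [← ofReal_integral_eq_lintegral_ofReal hint2]
        · congr 1
          rw [integral_mul_const, integral_add (integrable_const 1) (hint.mul_const _),
            integral_mul_const]
          simp [hμ]
        · filter_upwards [h01] with o ho
          refine mul_nonneg ?_ (Real.exp_pos _).le
          exact (Real.exp_pos _).le.trans (exp_mul_le_of_mem_Icc l ho)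
    _ ≤ 1 := by
        rw [← ENNReal.ofReal_one]
        refine ENNReal.ofReal_le_ofReal ?_
        have h := Real.add_one_le_exp (μ * (Real.exp l - 1))
        calc _ ≤ Real.exp (μ * (Real.exp l - 1)) * Real.exp (-(μ * (Real.exp l - 1))) :=
              mul_le_mul_of_nonneg_right (by linarith) (Real.exp_pos _).le
          _ = 1 := by rw [← Real.exp_add]; simp

/-- The reward (`none`) or the consumption of a resource (`some j`) in an outcome. -/
def coord (q : Option (Fin d)) (o : Outcome d) : ℝ := q.elim o.1 o.2

theorem measurable_coord (q : Option (Fin d)) : Measurable (coord q) := by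
  cases q with
  | none => exact measurable_fst
  | some j => exact (measurable_pi_apply j).comp measurable_snd

/-- The sum of a coordinate over the samples of an arm. -/
def sampleSum {t : ℕ} (h : History K d t) (q : Option (Fin d)) (a : Fin K) : ℝ :=
  ∑ s, if (h s).1 = a then coord q (h s).2 else 0

theorem measurable_numPulls (t : ℕ) (a : Fin K) :
    Measurable fun h : History K d t => numPulls h a := by
  unfold numPulls
  refine Finset.measurable_sum _ fun s _ => ?_
  exact (Measurable.of_discrete (f := fun b : Fin K => if b = a then 1 else 0)).comp
    (measurable_fst.comp (measurable_pi_apply s))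

section Sequence

theorem sum_past_eq_sum_range {M : Type*} [AddCommMonoid M] {n : ℕ} (ω : History K d n)
    (F : Round K d → M) (r₀ : Round K d) (t : Fin n) :
    ∑ s, F (past ω t s) = ∑ s ∈ Finset.range t, F (if h : s < n then ω ⟨s, h⟩ else r₀) := by
  rw [Finset.sum_range]
  refine Finset.sum_congr rfl fun s _ => ?_
  rw [dif_pos (s.isLt.trans t.isLt)]
  rfl

theorem sum_range_truncated (p : ℕ → Prop) [DecidablePred p] (v : ℕ → ℝ) {n t : ℕ} (ht : t ≤ n) :
    ∑ s ∈ Finset.range n, (if p s ∧ (∑ i ∈ Finset.range s, if p i then 1 else 0) <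
      (∑ i ∈ Finset.range t, if p i then 1 else 0) then v s else 0) =
      ∑ s ∈ Finset.range t, if p s then v s else 0 := by
  rw [← Finset.sum_subset (Finset.range_subset_range.2 ht)]
  · refine Finset.sum_congr rfl fun s hs => ?_
    by_cases hp : p s
    · have h1 : (∑ i ∈ Finset.range (s + 1), if p i then 1 else 0) ≤
          ∑ i ∈ Finset.range t, if p i then 1 else 0 :=
        Finset.sum_le_sum_of_subset
          (Finset.range_subset_range.2 (Nat.succ_le_of_lt (Finset.mem_range.1 hs)))
      rw [Finset.sum_range_succ, if_pos hp] at h1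
      rw [if_pos hp, if_pos ⟨hp, by omega⟩]
    · rw [if_neg hp, if_neg fun h => hp h.1]
  · intro s _ hs
    refine if_neg fun h => ?_
    have h1 : (∑ i ∈ Finset.range t, if p i then 1 else 0) ≤
        ∑ i ∈ Finset.range s, if p i then 1 else 0 :=
      Finset.sum_le_sum_of_subset
        (Finset.range_subset_range.2 (not_lt.1 fun h' => hs (Finset.mem_range.2 h')))
    exact absurd h.2 (not_lt.2 h1)

/-- A pull of `a` precedes round `t₀` exactly when fewer pulls of `a` precede it than precede `t₀`.
So a sum over a random time span becomes a sum over the whole run, cut off by a condition on each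
round's past. -/
theorem sum_truncated {n : ℕ} (ω : History K d n) (a : Fin K) (v : Outcome d → ℝ) (t₀ : Fin n) :
    ∑ t : Fin n, (if (ω t).1 = a ∧ numPulls (past ω t) a < numPulls (past ω t₀) a
      then v (ω t).2 else 0) =
      ∑ s, if (past ω t₀ s).1 = a then v (past ω t₀ s).2 else 0 := by
  have hN : ∀ t : Fin n, numPulls (past ω t) a = _ :=
    sum_past_eq_sum_range ω (fun r => if r.1 = a then 1 else 0) (ω t₀)
  rw [sum_past_eq_sum_range ω (fun r => if r.1 = a then v r.2 else 0) (ω t₀) t₀,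
    ← sum_range_truncated _ _ t₀.isLt.le, Finset.sum_range]
  refine Finset.sum_congr rfl fun t _ => ?_
  rw [hN, hN]
  simp only [t.isLt, dite_true, Fin.eta]

end Sequence

namespace Instance

variable (I : Instance K d) (π : Policy K d)

/-- The mean of a coordinate of the outcome of an arm. -/
noncomputable def mean (q : Option (Fin d)) (a : Fin K) : ℝ := ∫ o, coord q o ∂(I.dist a)

theorem coord_mem (q : Option (Fin d)) (a : Fin K) :
    ∀ᵐ o ∂(I.dist a), coord q o ∈ Set.Icc (0 : ℝ) 1 := by
  cases q with
  | none => exact I.reward_mem a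
  | some j => filter_upwards [I.cons_mem a] with o ho using ho j

theorem integrable_coord (q : Option (Fin d)) (a : Fin K) : Integrable (coord q) (I.dist a) := by
  have := I.dist_prob a
  exact Integrable.of_mem_Icc 0 1 (measurable_coord q).aemeasurable (I.coord_mem q a)

theorem mean_mem (q : Option (Fin d)) (a : Fin K) : I.mean q a ∈ Set.Icc (0 : ℝ) 1 := by
  have := I.dist_prob a
  constructor
  · exact integral_nonneg_of_ae ((I.coord_mem q a).mono fun _ h => h.1)
  · have h := integral_mono_ae (I.integrable_coord q a) (integrable_const 1)
      ((I.coord_mem q a).mono fun _ h => h.2)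
    refine h.trans ?_
    simp

/-- Keeping only the first `k` pulls of `a` replaces a union over rounds by one supermartingale. As
`k` is deterministic, `l` may later be tuned to it. -/
theorem law_sampleSum_tail_le (q : Option (Fin d)) (a : Fin K) (l : ℝ) (k n : ℕ) (x : ℝ) :
    I.law π n {ω | ∃ t : Fin n, numPulls (past ω t) a = k ∧
      x ≤ l * sampleSum (past ω t) q a - k * (I.mean q a * (Real.exp l - 1))} ≤
      ENNReal.ofReal (Real.exp (-x)) := by
  have hmv : Measurable fun o : Outcome d => l * coord q o - I.mean q a * (Real.exp l - 1) :=
    ((measurable_coord q).const_mul l).sub_const _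
  refine le_trans (measure_mono ?_) (I.law_sum_ge_le π
    (fun t p => if p.2.1 = a ∧ numPulls p.1 a < k then
      l * coord q p.2.2 - I.mean q a * (Real.exp l - 1) else 0) ?_ ?_ n x)
  · rintro ω ⟨t, hk, hx⟩
    subst hk
    simp only [Set.mem_ofPred_eq]
    rw [sum_truncated ω a (fun o => l * coord q o - I.mean q a * (Real.exp l - 1)) t]
    refine hx.trans (le_of_eq ?_)
    rw [sampleSum, numPulls, Nat.cast_sum, Finset.mul_sum, Finset.sum_mul,
      ← Finset.sum_sub_distrib]
    refine Finset.sum_congr rfl fun s _ => ?_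
    split_ifs <;> simp
  · intro t
    refine Measurable.ite ?_ (hmv.comp (measurable_snd.comp measurable_snd)) measurable_const
    refine MeasurableSet.inter ?_ ?_
    · exact (measurable_fst.comp measurable_snd) (MeasurableSet.singleton a)
    · exact ((measurable_numPulls t a).comp measurable_fst) (measurableSet_Iio (a := k))
  · intro t h
    refine I.lintegral_stepKernel_le_one π h ?_ fun b => ?_
    · refine ENNReal.measurable_ofReal.comp (Real.measurable_exp.comp ?_)
      refine Measurable.ite ?_ (hmv.comp measurable_snd) measurable_const
      refine MeasurableSet.inter (measurable_fst (MeasurableSet.singleton a)) ?_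
      exact MeasurableSet.const (numPulls h a < k)
    · have := I.dist_prob b
      by_cases hb : b = a ∧ numPulls h a < k
      · simp only [if_pos hb]
        rw [hb.1]
        have := I.dist_prob a
        exact lintegral_exp_centered_le_one _ (measurable_coord q) (I.coord_mem q a) l
      · simp [if_neg hb]

end Instance

/-! ### Chernoff exponents and the passage to empirical confidence radii. -/

section Rates

/-- The exponent for the Chernoff bound on the upper tail. -/
noncomputable def upperRate (C m : ℝ) : ℝ := if m < C then 1 else √(C / m)

/-- The exponent for the Chernoff bound on the lower tail. -/
noncomputable def lowerRate (C m : ℝ) : ℝ := -√(C / m)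

theorem exp_le_cubic {x : ℝ} (h0 : 0 ≤ x) (h1 : x ≤ 1) :
    Real.exp x ≤ 1 + x + x ^ 2 / 2 + x ^ 3 / 4 := by
  have h := Real.exp_bound' h0 h1 (n := 3) (by norm_num)
  norm_num [Finset.sum_range_succ, Nat.factorial] at h
  have : 0 ≤ x ^ 3 := by positivity
  linarith

theorem exp_neg_le_quadratic {x : ℝ} (h0 : 0 ≤ x) : Real.exp (-x) ≤ 1 - x + x ^ 2 / 2 := by
  have h := Real.quadratic_le_exp_of_nonneg h0
  rw [Real.exp_neg, inv_le_iff_one_le_mul₀ (Real.exp_pos x)]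
  have h2 : 0 ≤ 1 - x + x ^ 2 / 2 := by nlinarith [sq_nonneg (x - 1)]
  nlinarith [mul_le_mul_of_nonneg_left h h2, sq_nonneg (x ^ 2)]

/-- With `l = √(C / m)` one has `m * l ^ 2 = C`, which balances the deviation against the
second-order term of `exp`. The cubic bound needs `l ≤ 1`, hence the exponent 1 when `m < C`; there
`m ≤ √(C * m)` covers the excess. -/
theorem le_of_upperRate {C m S : ℝ} (hC : 0 < C) (hm : 0 ≤ m)
    (h : upperRate C m * S - m * (Real.exp (upperRate C m) - 1) < C / 2) :
    S ≤ m + √(C * m) + C := by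
  unfold upperRate at h
  split_ifs at h with hmC
  · have he := exp_le_cubic zero_le_one (le_refl (1 : ℝ))
    have h1 : m ≤ √(C * m) := Real.le_sqrt_of_sq_le (by nlinarith)
    nlinarith [mul_le_mul_of_nonneg_left he hm]
  · push Not at hmC
    have hm' : 0 < m := hC.trans_le hmC
    set l := √(C / m) with hl
    have hl0 : 0 < l := Real.sqrt_pos.2 (by positivity)
    have hl2 : l ^ 2 = C / m := Real.sq_sqrt (by positivity)
    have hl2' : m * l ^ 2 = C := by rw [hl2]; field_simp
    have hl1 : l ≤ 1 := by
      rw [hl, Real.sqrt_le_iff]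
      exact ⟨zero_le_one, by simpa using (div_le_one hm').2 hmC⟩
    have hs : √(C * m) = m * l := by
      rw [← Real.sqrt_sq (mul_pos hm' hl0).le]
      congr 1
      rw [← hl2']
      ring
    have he := mul_le_mul_of_nonneg_left (exp_le_cubic hl0.le hl1) hm
    rw [hs]
    have h2 : l * S ≤ l * (m + m * l + C) := by
      nlinarith [mul_pos hC hl0]
    exact le_of_mul_le_mul_left h2 hl0

/-- The quadratic bound on `exp (-x)` holds for all `x ≥ 0`, so the exponent needs no cap. For `m =
0` the rate degenerates to 0 and `0 ≤ S` is used instead. -/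
theorem ge_of_lowerRate {C m S : ℝ} (hC : 0 < C) (hm : 0 ≤ m) (hS : 0 ≤ S)
    (h : lowerRate C m * S - m * (Real.exp (lowerRate C m) - 1) < C / 2) :
    m - √(C * m) ≤ S := by
  unfold lowerRate at h
  rcases hm.eq_or_lt with rfl | hm'
  · simpa using hS
  · set l := √(C / m) with hl
    have hl0 : 0 < l := Real.sqrt_pos.2 (by positivity)
    have hl2 : l ^ 2 = C / m := Real.sq_sqrt (by positivity)
    have hl2' : m * l ^ 2 = C := by rw [hl2]; field_simp
    have hs : √(C * m) = m * l := by
      rw [← Real.sqrt_sq (mul_pos hm' hl0).le]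
      congr 1
      rw [← hl2']
      ring
    have he := mul_le_mul_of_nonneg_left (exp_neg_le_quadratic hl0.le) hm
    rw [hs]
    have h2 : l * (m - m * l) ≤ l * S := by nlinarith
    exact le_of_mul_le_mul_left h2 hl0

theorem sub_radius_le {c μ ν : ℝ} (hc : 0 ≤ c) (h : ν ≤ μ + √(c * μ) + c) :
    ν - (√(c * ν) + c) ≤ μ := by
  rcases le_total ν μ with h1 | h1
  · linarith [Real.sqrt_nonneg (c * ν)]
  · have := Real.sqrt_le_sqrt (mul_le_mul_of_nonneg_left h1 hc)
    linarith

theorem le_add_radius {c μ ν : ℝ} (hc : 0 ≤ c) (hμ : 0 ≤ μ) (hν : 0 ≤ ν)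
    (h : μ - √(c * μ) ≤ ν) : μ ≤ ν + (√(c * ν) + c) := by
  rw [Real.sqrt_mul hc] at h ⊢
  set x := √c with hx
  set y := √μ with hy
  set z := √ν with hz
  have hx2 : x ^ 2 = c := Real.sq_sqrt hc
  have hy2 : y ^ 2 = μ := Real.sq_sqrt hμ
  have hz2 : z ^ 2 = ν := Real.sq_sqrt hν
  have hx0 : 0 ≤ x := Real.sqrt_nonneg _
  have hy0 : 0 ≤ y := Real.sqrt_nonneg _
  have hz0 : 0 ≤ z := Real.sqrt_nonneg _
  rw [← hy2, ← hz2] at h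
  rw [← hy2, ← hz2, ← hx2]
  -- Otherwise `y * (y - x) > (x + z) * z ≥ z ^ 2`, against `h`. Then `y ^ 2 ≤ z ^ 2 + x * y`
  -- finishes: the radius at the mean is replaced by one at the estimate.
  have h1 : y ≤ x + z := by
    by_contra hcon
    push Not at hcon
    nlinarith
  nlinarith

end Rates

/-- The sample average of a coordinate of the outcomes of an arm. -/
noncomputable def sampleAvg {t : ℕ} (h : History K d t) (q : Option (Fin d)) (a : Fin K) : ℝ :=
  sampleSum h q a / numPulls h a

theorem numPulls_le {t : ℕ} (h : History K d t) (a : Fin K) : numPulls h a ≤ t := by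
  calc numPulls h a ≤ ∑ _s : Fin t, 1 := Finset.sum_le_sum fun s _ => by split_ifs <;> simp
    _ = t := by simp

theorem sampleSum_nonneg {t : ℕ} {h : History K d t} {q : Option (Fin d)} (a : Fin K)
    (h01 : ∀ s, coord q (h s).2 ∈ Set.Icc (0 : ℝ) 1) : 0 ≤ sampleSum h q a :=
  Finset.sum_nonneg fun s _ => by
    split_ifs
    exacts [(h01 s).1, le_rfl]

theorem sampleSum_le {t : ℕ} {h : History K d t} {q : Option (Fin d)} (a : Fin K)
    (h01 : ∀ s, coord q (h s).2 ∈ Set.Icc (0 : ℝ) 1) : sampleSum h q a ≤ numPulls h a := by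
  rw [numPulls, Nat.cast_sum]
  refine Finset.sum_le_sum fun s _ => ?_
  split_ifs
  · simpa using (h01 s).2
  · simp

theorem sampleAvg_mem {t : ℕ} {h : History K d t} {q : Option (Fin d)} (a : Fin K)
    (h01 : ∀ s, coord q (h s).2 ∈ Set.Icc (0 : ℝ) 1) : sampleAvg h q a ∈ Set.Icc (0 : ℝ) 1 :=
  ⟨div_nonneg (sampleSum_nonneg a h01) (Nat.cast_nonneg _),
    div_le_one_of_le₀ (sampleSum_le a h01) (Nat.cast_nonneg _)⟩

theorem proj_of_mem {x : ℝ} (h : x ∈ Set.Icc (0 : ℝ) 1) : proj x = x := by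
  rw [proj, min_eq_right h.2, max_eq_right h.1]

theorem proj_mono {x y : ℝ} (h : x ≤ y) : proj x ≤ proj y :=
  max_le_max le_rfl (min_le_min le_rfl h)

theorem proj_le_one (x : ℝ) : proj x ≤ 1 := max_le zero_le_one (min_le_left _ _)

theorem proj_le_self {x : ℝ} (h : 0 ≤ x) : proj x ≤ x := max_le h (min_le_right _ _)

theorem fRad_eq {C μ : ℝ} (N : ℕ) :
    fRad C μ N = min 1 (√(C / (max 1 N : ℕ) * μ) + C / (max 1 N : ℕ)) := by
  rw [fRad, div_mul_eq_mul_div]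

theorem fRad_le {C μ : ℝ} (hC : 0 ≤ C) (hμ : μ ≤ 1) (N : ℕ) :
    fRad C μ N ≤ 2 * √(C / (max 1 N : ℕ)) := by
  rw [fRad_eq]
  have hc : 0 ≤ C / (max 1 N : ℕ) := by positivity
  have hs := Real.sq_sqrt hc
  have hs0 := Real.sqrt_nonneg (C / (max 1 N : ℕ))
  rcases le_total 1 (√(C / (max 1 N : ℕ))) with h | h
  · exact (min_le_left _ _).trans (by linarith)
  · refine (min_le_right _ _).trans ?_
    have h1 := Real.sqrt_le_sqrt (mul_le_of_le_one_right hc hμ)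
    nlinarith

theorem abs_sub_le_fRad {C μ S : ℝ} {N : ℕ} (hC : 1 ≤ C) (hμ : μ ∈ Set.Icc (0 : ℝ) 1)
    (hS : S ∈ Set.Icc (0 : ℝ) N)
    (hu : S ≤ N * μ + √(C * (N * μ)) + C) (hl : N * μ - √(C * (N * μ)) ≤ S) :
    |S / N - μ| ≤ fRad C (S / N) N := by
  obtain ⟨hμ0, hμ1⟩ := hμ
  obtain ⟨hS0, hS1⟩ := hS
  rw [fRad_eq]
  -- Without samples the average is 0 by division by zero, and `1 ≤ C` makes the radius equal to 1.
  rcases Nat.eq_zero_or_pos N with rfl | hN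
  · simp only [Nat.cast_zero, div_zero, zero_sub, abs_neg, mul_zero, Real.sqrt_zero, zero_add]
    rw [abs_of_nonneg hμ0, max_eq_left zero_le_one, Nat.cast_one, div_one]
    exact le_min hμ1 (hμ1.trans hC)
  · have hN1 : (1 : ℝ) ≤ N := by exact_mod_cast hN
    have hN0 : (0 : ℝ) < N := by linarith
    rw [max_eq_right (Nat.succ_le_of_lt hN)]
    have hν0 : 0 ≤ S / N := by positivity
    have hν1 : S / N ≤ 1 := (div_le_one hN0).2 hS1
    have hc : 0 ≤ C / N := by positivity
    have hsq : √(C * (N * μ)) = N * √(C / N * μ) := by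
      rw [← Real.sqrt_sq hN0.le, ← Real.sqrt_mul (sq_nonneg _), Real.sqrt_sq hN0.le]
      congr 1
      field_simp
    rw [hsq] at hu hl
    have hu' : S / N ≤ μ + √(C / N * μ) + C / N := by
      rw [div_le_iff₀ hN0]
      calc S ≤ _ := hu
        _ = _ := by field_simp
    have hl' : μ - √(C / N * μ) ≤ S / N := by
      rw [le_div_iff₀ hN0]
      linarith
    have h1 := sub_radius_le hc hu'
    have h2 := le_add_radius hc hμ0 hν0 hl'
    refine le_min ?_ ?_ <;> rw [abs_le] <;> constructor <;> linarith

/-! ### The confidence event and the optimistic estimates. -/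

namespace Instance

variable (I : Instance K d) (π : Policy K d)

/-- All sample averages are within the confidence radius of the means. -/
def Confident (C : ℝ) {t : ℕ} (h : History K d t) : Prop :=
  ∀ q a, sampleAvg h q a ∈ Set.Icc (0 : ℝ) 1 ∧
    |sampleAvg h q a - I.mean q a| ≤ fRad C (sampleAvg h q a) (numPulls h a)

theorem ae_coord_mem (n : ℕ) :
    ∀ᵐ ω ∂(I.law π n), ∀ t : Fin n, ∀ q, coord q (ω t).2 ∈ Set.Icc (0 : ℝ) 1 := by
  refine I.ae_law π (P := fun r => ∀ q, coord q r.2 ∈ Set.Icc (0 : ℝ) 1) ?_ (fun a => ?_) n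
  · rw [Set.ofPred_forall]
    exact MeasurableSet.iInter fun q => ((measurable_coord q).comp measurable_snd) measurableSet_Icc
  · exact ae_all_iff.2 fun q => I.coord_mem q a

/-- A union bound over coordinate, arm, number of pulls and side of the deviation. `Fin n` suffices
for the number of pulls, since fewer than `n` rounds precede any round. -/
theorem law_not_confident_le {C : ℝ} (hC : 1 ≤ C) (n : ℕ) :
    I.law π n {ω | ¬ ∀ t : Fin n, I.Confident C (past ω t)} ≤
      ((d + 1) * K * n * 2 : ℕ) * ENNReal.ofReal (Real.exp (-(C / 2))) := by
  let rate : Bool → ℝ → ℝ := fun b m => if b then upperRate C m else lowerRate C m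
  let bad : Option (Fin d) × Fin K × Fin n × Bool → Set (History K d n) := fun i =>
    {ω | ∃ t : Fin n, numPulls (past ω t) i.2.1 = i.2.2.1 ∧
      C / 2 ≤ rate i.2.2.2 (i.2.2.1 * I.mean i.1 i.2.1) * sampleSum (past ω t) i.1 i.2.1 -
        (i.2.2.1 : ℕ) * (I.mean i.1 i.2.1 *
          (Real.exp (rate i.2.2.2 (i.2.2.1 * I.mean i.1 i.2.1)) - 1))}
  have hsub : {ω | ¬ ∀ t : Fin n, I.Confident C (past ω t)} ⊆
      {ω | ¬ ∀ t : Fin n, ∀ q, coord q (ω t).2 ∈ Set.Icc (0 : ℝ) 1} ∪ ⋃ i, bad i := by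
    intro ω hω
    by_contra hcon
    simp only [Set.mem_union, Set.mem_ofPred_eq, not_or, not_not, Set.mem_iUnion, not_exists]
      at hcon
    obtain ⟨h01, hgood⟩ := hcon
    refine hω fun t q a => ?_
    have h01' : ∀ s, coord q (past ω t s).2 ∈ Set.Icc (0 : ℝ) 1 := fun s => h01 _ q
    refine ⟨sampleAvg_mem a h01', ?_⟩
    have hb : ∀ b, rate b (numPulls (past ω t) a * I.mean q a) * sampleSum (past ω t) q a -
        (numPulls (past ω t) a * I.mean q a) *
          (Real.exp (rate b (numPulls (past ω t) a * I.mean q a)) - 1) < C / 2 := by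
      intro b
      have h := hgood ⟨q, a, ⟨numPulls (past ω t) a, (numPulls_le _ a).trans_lt t.isLt⟩, b⟩
      by_contra hcon
      refine h ⟨t, rfl, ?_⟩
      rw [← mul_assoc]
      exact not_lt.1 hcon
    have hC0 : 0 < C := by linarith
    have hm : 0 ≤ numPulls (past ω t) a * I.mean q a :=
      mul_nonneg (Nat.cast_nonneg _) (I.mean_mem q a).1
    exact abs_sub_le_fRad hC (I.mean_mem q a) ⟨sampleSum_nonneg a h01', sampleSum_le a h01'⟩
      (le_of_upperRate hC0 hm (hb true))
      (ge_of_lowerRate hC0 hm (sampleSum_nonneg a h01') (hb false))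
  refine (measure_mono hsub).trans ((measure_union_le _ _).trans ?_)
  rw [ae_iff.1 (I.ae_coord_mem π n), zero_add]
  refine (measure_iUnion_fintype_le _ _).trans ?_
  refine (Finset.sum_le_sum fun i _ => I.law_sampleSum_tail_le π i.1 i.2.1
    (rate i.2.2.2 (i.2.2.1 * I.mean i.1 i.2.1)) i.2.2.1 n (C / 2)).trans ?_
  rw [Finset.sum_const, nsmul_eq_mul]
  simp [mul_assoc]

theorem mean_time (a : Fin K) : I.mean (some I.time) a = I.B / I.T := by
  have := I.dist_prob a
  have h : (fun o => coord (some I.time) o) =ᵐ[I.dist a] fun _ => I.B / I.T := I.cons_time a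
  rw [mean, integral_congr_ae h]
  simp

theorem mean_none_null : I.mean none I.null = 0 := by
  have h : (fun o => coord none o) =ᵐ[I.dist I.null] fun _ => 0 := I.reward_null
  rw [mean, integral_congr_ae h]
  simp

variable {I} {γ : ℝ} {t : ℕ} {h : History K d t}

theorem Confident.mean_le_ucbReward (hc : I.Confident (I.Crad γ) h) (a : Fin K) :
    I.mean none a ≤ I.ucbReward γ h a := by
  unfold ucbReward
  split_ifs with ha
  · rw [ha, I.mean_none_null]
  · have h2 := (abs_le.1 (hc none a).2).1
    rw [← proj_of_mem (I.mean_mem none a)]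
    refine proj_mono ?_
    change _ ≤ sampleAvg h none a + fRad _ (sampleAvg h none a) _
    linarith

theorem Confident.lcbCons_le_mean (hc : I.Confident (I.Crad γ) h) (j : Fin d) (a : Fin K) :
    I.lcbCons γ h j a ≤ I.mean (some j) a := by
  unfold lcbCons
  split_ifs with hj ha
  · rw [hj, I.mean_time]
  · exact (I.mean_mem _ _).1
  · have h2 := (abs_le.1 (hc (some j) a).2).2
    rw [← proj_of_mem (I.mean_mem (some j) a)]
    refine proj_mono ?_
    change sampleAvg h (some j) a - fRad _ (sampleAvg h (some j) a) _ ≤ _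
    linarith

/-- The estimate adds one radius to an average that is itself within one radius of the mean, and
each radius is at most `2 * √(C / N)`, with `N` replaced by 1 if there are no pulls. -/
theorem Confident.ucbReward_sub_mean_le (hC : 0 ≤ I.Crad γ) (hc : I.Confident (I.Crad γ) h)
    (a : Fin K) :
    I.ucbReward γ h a - I.mean none a ≤ min 1 (4 * √(I.Crad γ / (max 1 (numPulls h a) : ℕ))) := by
  have hm := (I.mean_mem none a).1
  unfold ucbReward
  split_ifs with ha
  · refine le_trans (b := 0) (by linarith) (le_min zero_le_one (by positivity))
  · refine le_min (by linarith [proj_le_one (avgReward h a +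
      fRad (I.Crad γ) (avgReward h a) (numPulls h a))]) ?_
    change proj (sampleAvg h none a + fRad _ (sampleAvg h none a) _) - _ ≤ _
    obtain ⟨⟨h0, h1⟩, h2⟩ := hc none a
    have h3 := fRad_le hC h1 (numPulls h a)
    have h4 := (abs_le.1 h2).2
    have h5 := (abs_nonneg _).trans h2
    have h6 := proj_le_self (add_nonneg h0 h5)
    linarith

end Instance

/-! ### The benchmark against the optimistic linear program. -/

namespace Instance

variable (I : Instance K d) (π : Policy K d)

theorem lintegral_law_past {n : ℕ} (t : Fin n) {F : History K d t × Round K d → ℝ≥0∞}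
    (hF : Measurable F) :
    ∫⁻ ω, F (past ω t, ω t) ∂(I.law π n) =
      ∫⁻ h, ∑ a, π.kernel t h {a} * ∫⁻ o, F (h, (a, o)) ∂(I.dist a) ∂(I.law π t) := by
  have := I.isProb_law π t
  have := I.isMarkov_stepKernel π t
  have hm : Measurable fun ω : History K d n => (past ω t, ω t) :=
    (measurable_past t).prodMk (measurable_pi_apply t)
  rw [← lintegral_map hF hm, I.law_map_past π t, Measure.lintegral_compProd hF]
  exact lintegral_congr fun h =>
    I.lintegral_stepKernel π h (hF.comp measurable_prodMk_left)

theorem lintegral_coord (q : Option (Fin d)) (a : Fin K) :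
    ∫⁻ o, ENNReal.ofReal (coord q o) ∂(I.dist a) = ENNReal.ofReal (I.mean q a) :=
  (ofReal_integral_eq_lintegral_ofReal (I.integrable_coord q a)
    ((I.coord_mem q a).mono fun _ h => h.1)).symm

/-- Given the arm, the outcome is independent of the past, so on a past event each arm contributes
its mean times the probability of being drawn. -/
theorem lintegral_law_coord {n : ℕ} (t : Fin n) {A : Set (History K d t)} (hA : MeasurableSet A)
    (q : Option (Fin d)) :
    ∫⁻ ω, A.indicator 1 (past ω t) * ENNReal.ofReal (coord q (ω t).2) ∂(I.law π n) =
      ∑ a, ENNReal.ofReal (I.mean q a) * I.law π n {ω | past ω t ∈ A ∧ (ω t).1 = a} := by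
  have hind : Measurable (A.indicator (1 : History K d t → ℝ≥0∞)) := measurable_one.indicator hA
  have hco : Measurable fun o : Outcome d => ENNReal.ofReal (coord q o) :=
    ENNReal.measurable_ofReal.comp (measurable_coord q)
  have hker : ∀ a, Measurable fun h : History K d t => π.kernel t h {a} := fun a =>
    (π.kernel t).measurable_coe (MeasurableSet.singleton a)
  have harm : ∀ a, Measurable (({a} : Set (Fin K)).indicator (1 : Fin K → ℝ≥0∞)) := fun a =>
    Measurable.of_discrete
  have hprob : ∀ a, I.law π n {ω | past ω t ∈ A ∧ (ω t).1 = a} =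
      ∫⁻ h, A.indicator 1 h * π.kernel t h {a} ∂(I.law π t) := by
    intro a
    have hm : MeasurableSet {ω : History K d n | past ω t ∈ A ∧ (ω t).1 = a} :=
      (measurable_past t hA).inter ((measurable_fst.comp (measurable_pi_apply t))
        (MeasurableSet.singleton a))
    have h1 := I.lintegral_law_past π t (F := fun p => A.indicator 1 p.1 *
      ({a} : Set (Fin K)).indicator 1 p.2.1)
      ((hind.comp measurable_fst).mul ((harm a).comp (measurable_fst.comp measurable_snd)))
    rw [← lintegral_indicator_one hm]
    refine Eq.trans (lintegral_congr fun ω => ?_) (h1.trans (lintegral_congr fun h => ?_))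
    · by_cases h1 : past ω t ∈ A <;> by_cases h2 : (ω t).1 = a <;> simp [h1, h2]
    · rw [Finset.sum_eq_single a]
      · have := I.dist_prob a
        simp [mul_comm]
      · intro b _ hb
        simp [hb]
      · simp
  have h2 := I.lintegral_law_past π t (F := fun p => A.indicator 1 p.1 *
    ENNReal.ofReal (coord q p.2.2))
    ((hind.comp measurable_fst).mul (hco.comp (measurable_snd.comp measurable_snd)))
  refine h2.trans ?_
  simp only [hprob]
  have hmk : ∀ a, Measurable fun h : History K d t => A.indicator 1 h * π.kernel t h {a} :=
    fun a => hind.mul (hker a)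
  rw [Finset.sum_congr rfl fun a _ => (lintegral_const_mul _ (hmk a)).symm,
    ← lintegral_finsetSum _ fun a _ => (hmk a).const_mul _]
  refine lintegral_congr fun h => Finset.sum_congr rfl fun a _ => ?_
  rw [lintegral_const_mul _ hco, I.lintegral_coord]
  ring

theorem integral_law_coord {n : ℕ} (t : Fin n) {A : Set (History K d t)} (hA : MeasurableSet A)
    (q : Option (Fin d)) :
    Integrable (fun ω => A.indicator 1 (past ω t) * coord q (ω t).2) (I.law π n) ∧
    ∫ ω, A.indicator 1 (past ω t) * coord q (ω t).2 ∂(I.law π n) =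
      ∑ a, (I.law π n).real {ω | past ω t ∈ A ∧ (ω t).1 = a} * I.mean q a := by
  have := I.isProb_law π n
  have hm : Measurable fun ω : History K d n =>
      A.indicator (1 : History K d t → ℝ) (past ω t) * coord q (ω t).2 :=
    ((measurable_one.indicator hA).comp (measurable_past t)).mul
      ((measurable_coord q).comp (measurable_snd.comp (measurable_pi_apply t)))
  have h01 : ∀ᵐ ω ∂(I.law π n),
      A.indicator (1 : History K d t → ℝ) (past ω t) * coord q (ω t).2 ∈ Set.Icc (0 : ℝ) 1 := by
    filter_upwards [I.ae_coord_mem π n] with ω hω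
    by_cases h : past ω t ∈ A
    · simpa [h] using hω t q
    · simp [h]
  refine ⟨Integrable.of_mem_Icc 0 1 hm.aemeasurable h01, ?_⟩
  rw [integral_eq_lintegral_of_nonneg_ae (h01.mono fun _ h => h.1) hm.aestronglyMeasurable]
  have h3 : ∀ ω : History K d n,
      ENNReal.ofReal (A.indicator (1 : History K d t → ℝ) (past ω t) * coord q (ω t).2) =
      A.indicator 1 (past ω t) * ENNReal.ofReal (coord q (ω t).2) := by
    intro ω
    by_cases h : past ω t ∈ A <;> simp [h]
  simp_rw [h3]
  rw [I.lintegral_law_coord π t hA q, ENNReal.toReal_sum fun a _ =>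
    ENNReal.mul_ne_top ENNReal.ofReal_ne_top (measure_ne_top _ _)]
  refine Finset.sum_congr rfl fun a _ => ?_
  rw [ENNReal.toReal_mul, ENNReal.toReal_ofReal (I.mean_mem q a).1, mul_comm]
  rfl

/-- The histories after which no budget has been exceeded. -/
def alive (t : ℕ) : Set (History K d t) := {h | ∀ j, ∑ s, (h s).2.2 j ≤ I.B}

theorem measurableSet_alive (t : ℕ) : MeasurableSet (I.alive t) := by
  rw [alive, Set.ofPred_forall]
  refine MeasurableSet.iInter fun j => measurableSet_le ?_ measurable_const
  exact Finset.measurable_sum _ fun s _ => (measurable_pi_apply j).comp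
    (measurable_snd.comp (measurable_snd.comp (measurable_pi_apply s)))

theorem totalReward_eq (ω : History K d I.T) :
    I.totalReward ω = ∑ t : Fin I.T, (I.alive t).indicator 1 (past ω t) * coord none (ω t).2 := by
  unfold totalReward
  refine Finset.sum_congr rfl fun t _ => ?_
  by_cases h : ∀ j, ∑ s, (I.before ω t s).2.2 j ≤ I.B
  · have h' : past ω t ∈ I.alive t := h
    rw [Set.indicator_of_mem h', if_pos h]
    simp [coord]
  · have h' : past ω t ∉ I.alive t := h
    rw [Set.indicator_of_notMem h', if_neg h, zero_mul]

/-- A round counts only if the consumption before it is at most `B`, so only the last counted round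
can overshoot, by at most 1. -/
theorem sum_alive_cons_le {n : ℕ} (ω : History K d n) (j : Fin d)
    (h01 : ∀ t : Fin n, coord (some j) (ω t).2 ∈ Set.Icc (0 : ℝ) 1) :
    ∑ t : Fin n, (I.alive t).indicator 1 (past ω t) * coord (some j) (ω t).2 ≤ I.B + 1 := by
  induction n with
  | zero =>
    have := I.B_pos
    simp only [Finset.univ_eq_empty, Finset.sum_empty]
    linarith
  | succ n ih =>
    obtain ⟨ω', r, rfl⟩ : ∃ (ω' : History K d n) (r : Round K d),
        ω = (Fin.snoc ω' r : History K d (n + 1)) :=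
      ⟨Fin.init ω, ω (Fin.last n), (Fin.snoc_init_self (α := fun _ => Round K d) ω).symm⟩
    have h01' : ∀ t : Fin n, coord (some j) (ω' t).2 ∈ Set.Icc (0 : ℝ) 1 := fun t => by
      simpa using h01 t.castSucc
    have hlast : coord (some j) r.2 ∈ Set.Icc (0 : ℝ) 1 := by simpa using h01 (Fin.last n)
    simp only [Fin.sum_univ_castSucc, past_snoc_castSucc, past_snoc_last, Fin.snoc_castSucc,
      Fin.snoc_last, Fin.val_castSucc, Fin.val_last]
    by_cases h : ω' ∈ I.alive n
    · have h1 : ∑ t : Fin n, (I.alive t).indicator 1 (past ω' t) * coord (some j) (ω' t).2 ≤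
          ∑ t, coord (some j) (ω' t).2 := by
        refine Finset.sum_le_sum fun t _ => ?_
        refine mul_le_of_le_one_left (h01' t).1 ?_
        exact Set.indicator_le_self' (fun _ _ => zero_le_one) _
      have h2 : ∑ t, coord (some j) (ω' t).2 ≤ I.B := h j
      rw [Set.indicator_of_mem h]
      simp only [Pi.one_apply, one_mul]
      linarith [hlast.2]
    · rw [Set.indicator_of_notMem h, zero_mul, add_zero]
      exact ih ω' h01'

theorem exists_expected_pulls (ρ : Policy K d) :
    ∃ p : Fin K → ℝ, (∀ a, 0 ≤ p a) ∧ ∑ a, p a ≤ I.T ∧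
      I.expReward ρ = ∑ a, p a * I.mean none a ∧
      ∀ j, ∑ a, p a * I.mean (some j) a ≤ I.B + 1 := by
  have := I.isProb_law ρ I.T
  set S : Fin I.T → Fin K → Set (History K d I.T) :=
    fun t a => {ω | past ω t ∈ I.alive t ∧ (ω t).1 = a} with hS
  have key : ∀ q, ∫ ω, ∑ t : Fin I.T, (I.alive t).indicator 1 (past ω t) * coord q (ω t).2
      ∂(I.law ρ I.T) = ∑ a, (∑ t, (I.law ρ I.T).real (S t a)) * I.mean q a := by
    intro q
    rw [integral_finsetSum _ fun t _ =>
      (I.integral_law_coord ρ t (I.measurableSet_alive t) q).1]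
    simp_rw [(I.integral_law_coord ρ _ (I.measurableSet_alive _) q).2, Finset.sum_mul]
    exact Finset.sum_comm
  refine ⟨fun a => ∑ t, (I.law ρ I.T).real (S t a), fun a =>
    Finset.sum_nonneg fun t _ => measureReal_nonneg, ?_, ?_, fun j => ?_⟩
  · rw [Finset.sum_comm]
    calc _ ≤ ∑ _t : Fin I.T, (1 : ℝ) := Finset.sum_le_sum fun t _ => ?_
      _ = I.T := by simp
    rw [← measureReal_biUnion_finset]
    · exact measureReal_le_one
    · intro a _ b _ hab
      refine Set.disjoint_left.2 fun ω h1 h2 => hab (h1.2.symm.trans h2.2)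
    · intro a _
      exact (measurable_past t (I.measurableSet_alive t)).inter
        ((measurable_fst.comp (measurable_pi_apply t)) (MeasurableSet.singleton a))
  · rw [← key none, expReward]
    simp_rw [totalReward_eq]
  · rw [← key (some j)]
    have h1 := integral_mono_ae (μ := I.law ρ I.T)
      (integrable_finsetSum Finset.univ fun t _ =>
        (I.integral_law_coord ρ t (I.measurableSet_alive t) (some j)).1)
      (integrable_const (I.B + 1))
      ((I.ae_coord_mem ρ I.T).mono fun ω hω => I.sum_alive_cons_le ω j fun t => hω t (some j))
    refine h1.trans ?_
    simp

theorem expReward_le (ρ : Policy K d) : I.expReward ρ ≤ I.T := by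
  obtain ⟨p, h0, h1, h2, -⟩ := I.exists_expected_pulls ρ
  rw [h2]
  exact (Finset.sum_le_sum fun a _ => mul_le_of_le_one_right (h0 a) (I.mean_mem none a).2).trans h1

/-- The expected pull counts of `ρ`, rescaled, compete with `X` in the optimistic program: lower
consumption bounds keep them feasible, and upper reward bounds keep their value. -/
theorem expReward_mul_le {γ : ℝ} {t : ℕ} {h : History K d t} {X : Fin K → ℝ}
    (hX : I.IsOptimistic γ h X) (hc : I.Confident (I.Crad γ) h) (hη0 : 0 ≤ I.etaLP)
    (hη1 : I.etaLP ≤ 1) (ρ : Policy K d) :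
    I.expReward ρ * (1 - I.etaLP) ≤ I.T * (1 + 1 / I.B) * ∑ a, X a * I.ucbReward γ h a := by
  obtain ⟨p, hp0, hpT, hpr, hpc⟩ := I.exists_expected_pulls ρ
  have hB := I.B_pos
  have hT : (0 : ℝ) < I.T := by exact_mod_cast I.T_pos
  -- The factor `1 + 1 / B` pays for the overshoot: `(B + 1) / D = B / T`, so `κ` meets the rescaled
  -- constraint exactly.
  set D := I.T * (1 + 1 / I.B) with hD
  have hD0 : 0 < D := by positivity
  set κ := (1 - I.etaLP) / D with hκ
  have hκ0 : 0 ≤ κ := div_nonneg (by linarith) hD0.le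
  have hκp : κ * ∑ a, p a ≤ 1 := by
    refine (mul_le_mul_of_nonneg_left hpT hκ0).trans ?_
    rw [hκ, div_mul_eq_mul_div, div_le_one hD0, hD]
    have : 0 ≤ 1 / I.B := by positivity
    nlinarith
  -- The null arm completes the mass to 1 at no reward and no consumption other than time.
  set Y : Fin K → ℝ := fun a => κ * p a + if a = I.null then 1 - κ * ∑ b, p b else 0 with hY
  have hsumY : ∀ f : Fin K → ℝ,
      ∑ a, Y a * f a = κ * ∑ a, p a * f a + (1 - κ * ∑ b, p b) * f I.null := by
    intro f
    simp only [hY, add_mul, ite_mul, zero_mul, Finset.sum_add_distrib, Finset.sum_ite_eq',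
      Finset.mem_univ, if_true, Finset.mul_sum, mul_assoc]
  have hYs : ∑ a, Y a = 1 := by
    have := hsumY fun _ => 1
    simp only [mul_one] at this
    linarith
  have hYf : Y ∈ I.optimisticFeasible γ h := by
    refine ⟨⟨fun a => ?_, hYs⟩, fun j => ?_⟩
    · refine add_nonneg (mul_nonneg hκ0 (hp0 a)) ?_
      split_ifs
      · linarith
      · exact le_rfl
    · by_cases hj : j = I.time
      · simp only [lcbCons, if_pos hj]
        rw [← Finset.sum_mul, hYs, one_mul]
      · rw [if_neg hj, hsumY]
        have h0 : I.lcbCons γ h j I.null = 0 := by simp [lcbCons, hj]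
        rw [h0, mul_zero, add_zero]
        have h1 : ∑ a, p a * I.lcbCons γ h j a ≤ I.B + 1 :=
          (Finset.sum_le_sum fun a _ =>
            mul_le_mul_of_nonneg_left (hc.lcbCons_le_mean j a) (hp0 a)).trans (hpc j)
        refine (mul_le_mul_of_nonneg_left h1 hκ0).trans (le_of_eq ?_)
        rw [hκ, hD]
        field_simp
  have h2 : ∑ a, Y a * I.ucbReward γ h a ≤ ∑ a, X a * I.ucbReward γ h a := hX.2 hYf
  rw [hsumY] at h2
  have h0 : I.ucbReward γ h I.null = 0 := by simp [ucbReward]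
  rw [h0, mul_zero, add_zero] at h2
  have h3 : ∑ a, p a * I.mean none a ≤ ∑ a, p a * I.ucbReward γ h a :=
    Finset.sum_le_sum fun a _ => mul_le_mul_of_nonneg_left (hc.mean_le_ucbReward a) (hp0 a)
  have h4 := (mul_le_mul_of_nonneg_left h3 hκ0).trans h2
  rw [← hpr, hκ, div_mul_eq_mul_div, div_le_iff₀ hD0] at h4
  linarith

theorem OPTDP_div_le_one (π : Policy K d) : I.OPTDP / I.T ≤ 1 := by
  have hT : (0 : ℝ) < I.T := by exact_mod_cast I.T_pos
  have : Nonempty (Policy K d) := ⟨π⟩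
  exact (div_le_one hT).2 (ciSup_le I.expReward_le)

theorem simpleRegret_le_of_confident {γ : ℝ} {t : ℕ} {h : History K d t} (π : Policy K d)
    (hX : I.IsOptimistic γ h (π.choice h)) (hc : I.Confident (I.Crad γ) h) (hη0 : 0 ≤ I.etaLP)
    (hη1 : I.etaLP < 1) (hC : 0 ≤ I.Crad γ) :
    I.simpleRegret (π.choice h) ≤ I.etaLP + 1 / I.B +
      ∑ a, π.choice h a * min 1 (4 * √(I.Crad γ / (max 1 (numPulls h a) : ℕ))) := by
  have hB := I.B_pos
  have hT : (0 : ℝ) < I.T := by exact_mod_cast I.T_pos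
  have : Nonempty (Policy K d) := ⟨π⟩
  set U := ∑ a, π.choice h a * I.ucbReward γ h a with hU
  have h1 : I.OPTDP ≤ I.T * (1 + 1 / I.B) * U / (1 - I.etaLP) := ciSup_le fun ρ => by
    rw [le_div_iff₀ (by linarith)]
    exact I.expReward_mul_le hX hc hη0 hη1.le ρ
  rw [le_div_iff₀ (by linarith)] at h1
  have h2 := I.OPTDP_div_le_one π
  set o := I.OPTDP / I.T with ho
  have h3 : o * (1 - I.etaLP) ≤ (1 + 1 / I.B) * U := by
    rw [ho, div_mul_eq_mul_div, div_le_iff₀ hT]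
    linarith
  have hU1 : U - ∑ a, π.choice h a * I.meanReward a ≤
      ∑ a, π.choice h a * min 1 (4 * √(I.Crad γ / (max 1 (numPulls h a) : ℕ))) := by
    rw [hU, ← Finset.sum_sub_distrib]
    refine Finset.sum_le_sum fun a _ => ?_
    rw [← mul_sub]
    exact mul_le_mul_of_nonneg_left (hc.ucbReward_sub_mean_le hC a) (choice_nonneg π h a)
  have h4 : o ≤ I.etaLP + 1 / I.B + U := by
    have hb : 0 < 1 / I.B := by positivity
    set b := 1 / I.B
    -- By `h3`, the left side is at most `(etaLP + b) * o`, and `o ≤ 1`.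
    have h5 : (1 + b) * (o - U) ≤ (1 + b) * (I.etaLP + b) := by nlinarith
    have h6 := le_of_mul_le_mul_left h5 (by linarith)
    linarith
  unfold simpleRegret
  linarith

theorem simpleRegret_le_one (π : Policy K d) {t : ℕ} (h : History K d t) :
    I.simpleRegret (π.choice h) ≤ 1 := by
  have h1 := I.OPTDP_div_le_one π
  have h2 : 0 ≤ ∑ a, π.choice h a * I.meanReward a :=
    Finset.sum_nonneg fun a _ => mul_nonneg (choice_nonneg π h a) (I.mean_mem none a).1
  unfold simpleRegret
  linarith

theorem simpleRegret_nonpos_of_unique (hK : K = 1) (π : Policy K d) {t : ℕ} (h : History K d t) :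
    I.simpleRegret (π.choice h) ≤ 0 := by
  subst hK
  have hT : (0 : ℝ) < I.T := by exact_mod_cast I.T_pos
  have : Nonempty (Policy 1 d) := ⟨π⟩
  have h0 : ∀ a, I.mean none a = 0 := fun a => by
    rw [Subsingleton.elim a I.null, I.mean_none_null]
  have h1 : I.OPTDP ≤ 0 := ciSup_le fun ρ => by
    obtain ⟨p, -, -, h2, -⟩ := I.exists_expected_pulls ρ
    rw [h2]
    simp [h0]
  have h2 : ∑ a, π.choice h a * I.meanReward a = 0 :=
    Finset.sum_eq_zero fun a _ => by
      change _ * I.mean none a = 0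
      rw [h0, mul_zero]
  unfold simpleRegret
  rw [h2, sub_zero]
  exact div_nonpos_of_nonpos_of_nonneg h1 hT.le

end Instance

/-! ### Expected and realized radii in selected rounds. -/

/-- A bound on the amount by which the optimistic estimates for an arm exceed the means. -/
noncomputable def radius (C : ℝ) {t : ℕ} (h : History K d t) (a : Fin K) : ℝ :=
  min 1 (4 * √(C / (max 1 (numPulls h a) : ℕ)))

theorem radius_mem (C : ℝ) {t : ℕ} (h : History K d t) (a : Fin K) :
    radius C h a ∈ Set.Icc (0 : ℝ) 1 :=
  ⟨le_min zero_le_one (by positivity), min_le_left _ _⟩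

theorem measurable_radius (C : ℝ) (t : ℕ) (a : Fin K) :
    Measurable fun h : History K d t => radius C h a := by
  have h1 : Measurable fun N : ℕ => min (1 : ℝ) (4 * √(C / (max 1 N : ℕ))) := Measurable.of_discrete
  exact h1.comp (measurable_numPulls t a)

theorem measurable_radius_arm (C : ℝ) (t : ℕ) :
    Measurable fun p : History K d t × Round K d => radius C p.1 p.2.1 := by
  have h1 : (fun p : History K d t × Round K d => radius C p.1 p.2.1) =
      fun p => ∑ a, if p.2.1 = a then radius C p.1 a else 0 := by
    funext p
    simp
  rw [h1]
  refine Finset.measurable_sum _ fun a _ => ?_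
  exact Measurable.ite ((measurable_fst.comp measurable_snd) (MeasurableSet.singleton a))
    ((measurable_radius C t a).comp measurable_fst) measurable_const

/-- The expected radius of the arm that is chosen after a history. -/
noncomputable def expRadius (π : Policy K d) (C : ℝ) {t : ℕ} (h : History K d t) : ℝ :=
  ∑ a, π.choice h a * radius C h a

theorem measurable_expRadius (π : Policy K d) (C : ℝ) (t : ℕ) :
    Measurable fun h : History K d t => expRadius π C h := by
  refine Finset.measurable_sum _ fun a _ => ?_
  exact ((π.kernel t).measurable_coe (MeasurableSet.singleton a)).ennreal_toReal.mul
    (measurable_radius C t a)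

theorem exp_neg_le_one_sub_half {y : ℝ} (hy : y ∈ Set.Icc (0 : ℝ) 1) :
    Real.exp (-y) ≤ 1 - y / 2 := by
  have h1 := exp_mul_le_of_mem_Icc (-1) hy
  have h2 := exp_neg_le_quadratic zero_le_one
  rw [neg_one_mul] at h1
  nlinarith [hy.1]

/-- The mean of `exp (-w)` is at most `1 - Z / 2 ≤ exp (-(Z / 2))`. Giving up the factor 2 is what
removes any variance term. -/
theorem sum_choice_mul_exp_le_one (π : Policy K d) {t : ℕ} (h : History K d t) {w : Fin K → ℝ}
    (hw : ∀ a, w a ∈ Set.Icc (0 : ℝ) 1) :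
    ∑ a, π.choice h a * Real.exp ((∑ b, π.choice h b * w b) / 2 - w a) ≤ 1 := by
  set Z := ∑ b, π.choice h b * w b with hZ
  have h1 : ∑ a, π.choice h a * Real.exp (Z / 2 - w a) ≤
      ∑ a, Real.exp (Z / 2) * (π.choice h a - π.choice h a * w a / 2) := by
    refine Finset.sum_le_sum fun a _ => ?_
    rw [sub_eq_add_neg, Real.exp_add]
    have := mul_le_mul_of_nonneg_left (exp_neg_le_one_sub_half (hw a))
      (mul_nonneg (Instance.choice_nonneg π h a) (Real.exp_pos (Z / 2)).le)
    linarith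
  refine h1.trans ?_
  rw [← Finset.mul_sum, Finset.sum_sub_distrib, Instance.sum_choice, ← Finset.sum_div, ← hZ]
  have h2 := Real.add_one_le_exp (-(Z / 2))
  calc Real.exp (Z / 2) * (1 - Z / 2) ≤ Real.exp (Z / 2) * Real.exp (-(Z / 2)) :=
        mul_le_mul_of_nonneg_left (by linarith) (Real.exp_pos _).le
    _ = 1 := by rw [← Real.exp_add]; simp

/-- The increment of the square root is at least `1 / (2 * √(m + 1))`, and `4 * (m + 1) ≤ 9 * max 1
N`. -/
theorem inv_sqrt_le_sqrt_sub {m N : ℕ} (h : m ≤ N) :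
    1 / √((max 1 N : ℕ) : ℝ) ≤ 3 * (√((m : ℝ) + 1) - √m) := by
  have hm1 : 0 < √((m : ℝ) + 1) := Real.sqrt_pos.2 (by positivity)
  have hm0 := Real.sqrt_nonneg (m : ℝ)
  have hs1 : √((m : ℝ) + 1) ^ 2 = m + 1 := Real.sq_sqrt (by positivity)
  have hs0 : √(m : ℝ) ^ 2 = m := Real.sq_sqrt (by positivity)
  have hle : √(m : ℝ) ≤ √((m : ℝ) + 1) := Real.sqrt_le_sqrt (by linarith)
  set M := max 1 N with hM
  have hM1 : (1 : ℝ) ≤ M := by exact_mod_cast le_max_left 1 N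
  have hMm : (m : ℝ) ≤ M := by exact_mod_cast h.trans (le_max_right 1 N)
  have hMs : 0 < √(M : ℝ) := Real.sqrt_pos.2 (by linarith)
  have h2 : 2 * √((m : ℝ) + 1) ≤ 3 * √(M : ℝ) := by
    refine (sq_le_sq₀ (by positivity) (by positivity)).1 ?_
    rw [mul_pow, mul_pow, hs1, Real.sq_sqrt (by linarith)]
    linarith
  rw [div_le_iff₀ hMs]
  nlinarith

/-- An arm has been pulled at least as often as it was pulled in selected rounds, so the sum
telescopes in the selected counts. The bound thus involves the number of selected rounds and not
`n`. -/
theorem sum_selected_inv_sqrt_le {n : ℕ} (sel : (t : ℕ) → Set (History K d t))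
    [∀ t, DecidablePred (· ∈ sel t)] (ω : History K d n) :
    ∑ t : Fin n, (if past ω t ∈ sel t then
        1 / √((max 1 (numPulls (past ω t) (ω t).1) : ℕ) : ℝ) else 0) ≤
      3 * ∑ a, √((∑ t : Fin n, if past ω t ∈ sel t ∧ (ω t).1 = a then 1 else 0 : ℕ) : ℝ) := by
  induction n with
  | zero => simp
  | succ n ih =>
    obtain ⟨ω', r, rfl⟩ : ∃ (ω' : History K d n) (r : Round K d),
        ω = (Fin.snoc ω' r : History K d (n + 1)) :=
      ⟨Fin.init ω, ω (Fin.last n), (Fin.snoc_init_self (α := fun _ => Round K d) ω).symm⟩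
    simp only [Fin.sum_univ_castSucc, past_snoc_castSucc, past_snoc_last, Fin.snoc_castSucc,
      Fin.snoc_last, Fin.val_castSucc, Fin.val_last]
    set c : Fin K → ℕ := fun a =>
      ∑ t : Fin n, if past ω' t ∈ sel t ∧ (ω' t).1 = a then 1 else 0 with hc
    have ih' := ih ω'
    change _ ≤ 3 * ∑ a, √((c a : ℕ) : ℝ) at ih'
    change _ ≤ 3 * ∑ a, √((c a + _ : ℕ) : ℝ)
    by_cases hs : ω' ∈ sel n
    · have h1 : ∀ a, √((c a + (if ω' ∈ sel n ∧ r.1 = a then 1 else 0) : ℕ) : ℝ) =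
          √(c a : ℝ) + if r.1 = a then √((c r.1 : ℝ) + 1) - √(c r.1 : ℝ) else 0 := by
        intro a
        by_cases ha : r.1 = a
        · subst ha
          simp [hs]
        · simp [ha]
      simp only [h1, Finset.sum_add_distrib, Finset.sum_ite_eq, Finset.mem_univ, if_true,
        if_pos hs]
      have h2 : c r.1 ≤ numPulls ω' r.1 := by
        refine Finset.sum_le_sum fun t _ => ?_
        split_ifs with h3 h4
        exacts [le_rfl, absurd h3.2 h4, zero_le_one, le_rfl]
      have := inv_sqrt_le_sqrt_sub h2
      linarith
    · simpa [hs] using ih'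

theorem sum_selected_radius_le {n : ℕ} {C : ℝ} (hC : 0 ≤ C) (sel : (t : ℕ) → Set (History K d t))
    [∀ t, DecidablePred (· ∈ sel t)] (ω : History K d n) :
    ∑ t : Fin n, (if past ω t ∈ sel t then radius C (past ω t) (ω t).1 else 0) ≤
      12 * √(C * K * (∑ t : Fin n, if past ω t ∈ sel t then 1 else 0 : ℕ)) := by
  set c : Fin K → ℕ := fun a =>
    ∑ t : Fin n, if past ω t ∈ sel t ∧ (ω t).1 = a then 1 else 0 with hc
  have hsum : ∑ a, c a = ∑ t : Fin n, if past ω t ∈ sel t then 1 else 0 := by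
    rw [hc, Finset.sum_comm]
    refine Finset.sum_congr rfl fun t _ => ?_
    by_cases h : past ω t ∈ sel t <;> simp [h]
  have h1 : ∑ t : Fin n, (if past ω t ∈ sel t then radius C (past ω t) (ω t).1 else 0) ≤
      4 * √C * ∑ t : Fin n, (if past ω t ∈ sel t then
        1 / √((max 1 (numPulls (past ω t) (ω t).1) : ℕ) : ℝ) else 0) := by
    rw [Finset.mul_sum]
    refine Finset.sum_le_sum fun t _ => ?_
    split_ifs
    · refine (min_le_right _ _).trans (le_of_eq ?_)
      rw [Real.sqrt_div hC]
      ring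
    · simp
  have h2 : ∑ a, √(c a : ℝ) ≤ √(K * (∑ a, c a : ℕ)) := by
    refine Real.le_sqrt_of_sq_le ?_
    have h3 := sq_sum_le_card_mul_sum_sq (s := Finset.univ) (f := fun a : Fin K => √(c a : ℝ))
    simp only [Finset.card_univ, Fintype.card_fin, Real.sq_sqrt (Nat.cast_nonneg _)] at h3
    rwa [Nat.cast_sum]
  rw [hsum] at h2
  have h4 := (sum_selected_inv_sqrt_le sel ω).trans (mul_le_mul_of_nonneg_left h2 zero_le_three)
  refine (h1.trans (mul_le_mul_of_nonneg_left h4 (by positivity))).trans (le_of_eq ?_)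
  rw [mul_assoc C, Real.sqrt_mul hC]
  ring

namespace Instance

variable (I : Instance K d) (π : Policy K d)

open Classical in
/-- Half the expected radius minus the radius of the chosen arm, in the rounds in which the
expected radius is at least `θ`. -/
noncomputable def radiusGap (C θ : ℝ) {t : ℕ} (p : History K d t × Round K d) : ℝ :=
  if θ ≤ expRadius π C p.1 then expRadius π C p.1 / 2 - radius C p.1 p.2.1 else 0

theorem measurable_radiusGap (C θ : ℝ) (t : ℕ) :
    Measurable fun p : History K d t × Round K d => radiusGap π C θ p := by
  have h1 : Measurable fun p : History K d t × Round K d => expRadius π C p.1 :=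
    (measurable_expRadius π C t).comp measurable_fst
  exact Measurable.ite (h1 measurableSet_Ici)
    ((h1.div_const 2).sub (measurable_radius_arm C t)) measurable_const

/-- Whether a round is selected is decided by its past, so selection preserves the supermartingale
property. -/
theorem lintegral_exp_radiusGap_le_one (C θ : ℝ) {t : ℕ} (h : History K d t) :
    ∫⁻ r, ENNReal.ofReal (Real.exp (radiusGap π C θ (h, r))) ∂(I.stepKernel π t h) ≤ 1 := by
  have hm : Measurable fun r : Round K d => radiusGap π C θ (h, r) :=
    (measurable_radiusGap π C θ t).comp measurable_prodMk_left
  refine (I.lintegral_stepKernel π h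
    (ENNReal.measurable_ofReal.comp (Real.measurable_exp.comp hm))).trans_le ?_
  have hp : ∀ a, ∀ c : ℝ≥0∞, ∫⁻ _o, c ∂(I.dist a) = c := fun a c => by
    have := I.dist_prob a
    simp
  by_cases hθ : θ ≤ expRadius π C h
  · simp only [radiusGap, if_pos hθ, Function.comp, hp]
    have := π.markov t
    have h1 : ∀ a, π.kernel t h {a} = ENNReal.ofReal (π.choice h a) := fun a =>
      (ENNReal.ofReal_toReal (measure_ne_top _ _)).symm
    simp_rw [h1, ← ENNReal.ofReal_mul (choice_nonneg π h _)]
    rw [← ENNReal.ofReal_sum_of_nonneg fun a _ =>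
      mul_nonneg (choice_nonneg π h a) (Real.exp_pos _).le]
    exact ENNReal.ofReal_le_one.2 (sum_choice_mul_exp_le_one π h (radius_mem C h))
  · simp only [radiusGap, if_neg hθ, Function.comp, hp, Real.exp_zero, ENNReal.ofReal_one, mul_one]
    exact (sum_kernel_singleton π h).le

theorem law_radiusGap_tail_le (C θ x : ℝ) (n : ℕ) :
    I.law π n {ω | x ≤ ∑ t : Fin n, radiusGap π C θ (past ω t, ω t)} ≤
      ENNReal.ofReal (Real.exp (-x)) :=
  I.law_sum_ge_le π (fun _ p => radiusGap π C θ p) (measurable_radiusGap π C θ)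
    (fun _ h => I.lintegral_exp_radiusGap_le_one π C θ h) n x

open Classical in
theorem card_selected_mul_le {C θ x : ℝ} (hC : 0 ≤ C) {n : ℕ} {ω : History K d n}
    (h : ∑ t : Fin n, radiusGap π C θ (past ω t, ω t) < x) :
    ({t : Fin n | θ ≤ expRadius π C (past ω t)} : Set (Fin n)).ncard * θ ≤
      24 * √(C * K * ({t : Fin n | θ ≤ expRadius π C (past ω t)} : Set (Fin n)).ncard)
        + 2 * x := by
  have hcard : ({t : Fin n | θ ≤ expRadius π C (past ω t)} : Set (Fin n)).ncard =
      ∑ t : Fin n, if θ ≤ expRadius π C (past ω t) then 1 else 0 := by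
    rw [Set.ncard_eq_toFinset_card', Finset.card_eq_sum_ones, ← Finset.sum_filter]
    congr 1
    ext t
    simp
  have h1 := sum_selected_radius_le hC (fun t => {h : History K d t | θ ≤ expRadius π C h}) ω
  simp only [Set.mem_ofPred_eq] at h1
  rw [hcard]
  set s := ∑ t : Fin n, if θ ≤ expRadius π C (past ω t) then 1 else 0 with hs
  have h2 : (s : ℝ) * (θ / 2) ≤ ∑ t : Fin n, (if θ ≤ expRadius π C (past ω t) then
      expRadius π C (past ω t) / 2 else 0) := by
    rw [hs, Nat.cast_sum, Finset.sum_mul]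
    refine Finset.sum_le_sum fun t _ => ?_
    split_ifs with h3
    · simpa using by linarith
    · simp
  have h4 : ∑ t : Fin n, radiusGap π C θ (past ω t, ω t) =
      ∑ t : Fin n, (if θ ≤ expRadius π C (past ω t) then
        expRadius π C (past ω t) / 2 else 0) -
      ∑ t : Fin n, (if θ ≤ expRadius π C (past ω t) then
        radius C (past ω t) (ω t).1 else 0) := by
    rw [← Finset.sum_sub_distrib]
    refine Finset.sum_congr rfl fun t _ => ?_
    unfold radiusGap
    split_ifs <;> simp
  linarith

end Instance

/-! ### Counting the rounds of large regret, and the failure probability. -/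

theorem le_of_quadratic_bound {s ε a L : ℝ} (hs : 0 ≤ s) (hε : 0 < ε) (hε1 : ε ≤ 1)
    (ha : 0 ≤ a) (hL : 0 ≤ L) (h : s * (ε / 8) ≤ 24 * √(a * s) + 8 * L) :
    s ≤ (36864 * a + 128 * L) / ε ^ 2 := by
  rw [Real.sqrt_mul ha] at h
  have hy := Real.sq_sqrt ha
  have hz := Real.sq_sqrt hs
  set y := √a
  set z := √s
  rw [le_div_iff₀ (by positivity)]
  have h1 := mul_le_mul_of_nonneg_left h hε.le
  have h2 : ε * L ≤ L := mul_le_of_le_one_left hL hε1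
  -- With `u = ε * z`, `h1` reads `u ^ 2 ≤ 192 * y * u + 64 * ε * L`; the square absorbs the cross
  -- term into `u ^ 2 / 2`, and `192 ^ 2 = 36864`.
  nlinarith [sq_nonneg (ε * z - 192 * y)]

namespace Instance

variable (I : Instance K d) (π : Policy K d)

theorem prod_pos : 0 < K * I.T * d :=
  Nat.mul_pos (Nat.mul_pos I.null.pos I.T_pos) I.time.pos

theorem logKTd_eq : I.logKTd = Real.log ((K * I.T * d : ℕ) : ℝ) := by
  unfold logKTd
  push_cast
  rfl

theorem logKTd_nonneg : 0 ≤ I.logKTd := by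
  rw [logKTd_eq]
  exact Real.log_natCast_nonneg _

theorem lt_logKTd (h : 2 ≤ K * I.T * d) : 0.69 < I.logKTd := by
  rw [logKTd_eq]
  have h2 : (2 : ℝ) ≤ (K * I.T * d : ℕ) := by exact_mod_cast h
  have := Real.log_le_log two_pos h2
  linarith [Real.log_two_gt_d9]

theorem exp_neg_four_mul_logKTd :
    Real.exp (-(4 * I.logKTd)) = 1 / ((K * I.T * d : ℕ) : ℝ) ^ 4 := by
  have h0 : (0 : ℝ) < (K * I.T * d : ℕ) := by exact_mod_cast I.prod_pos
  rw [logKTd_eq, Real.exp_neg, ← Nat.cast_ofNat (R := ℝ), Real.exp_nat_mul, Real.exp_log h0,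
    one_div]

theorem etaLP_nonneg : 0 ≤ I.etaLP := by
  have := I.B_pos
  unfold etaLP
  positivity

/-- With `x = K * L / B`, `etaLP ≤ 1 / 2` forces `√x ≤ 1 / 6`, so `0.69 / B ≤ x ≤ √x / 6`, while `3
* √x ≤ etaLP`. -/
theorem inv_budget_le_etaLP (h : 2 ≤ K * I.T * d) (hη : I.etaLP ≤ 1 / 2) :
    1 / I.B ≤ I.etaLP / 12 := by
  have hB := I.B_pos
  have hL := I.lt_logKTd h
  have hK : (1 : ℝ) ≤ K := by exact_mod_cast I.null.pos
  have hx0 : 0 ≤ K / I.B * I.logKTd := by positivity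
  have hs0 := Real.sqrt_nonneg (K / I.B * I.logKTd)
  have hs := Real.sq_sqrt hx0
  have hy : 0 ≤ K / I.B * I.logKTd ^ 2 := by positivity
  have h1 : 0.69 * (1 / I.B) ≤ K / I.B * I.logKTd := by
    rw [div_mul_eq_mul_div, mul_one_div]
    refine div_le_div_of_nonneg_right ?_ hB.le
    nlinarith
  have hb : 0 < 1 / I.B := by positivity
  unfold etaLP at hη ⊢
  nlinarith

theorem etaLP_sq_le {M : ℝ} (hM : K * I.logKTd ^ 3 ≤ M * I.B) :
    I.etaLP ^ 2 ≤ 18 * (1 + M) * (K * I.logKTd / I.B) := by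
  have hB := I.B_pos
  have hL := I.logKTd_nonneg
  have hx0 : 0 ≤ K / I.B * I.logKTd := by positivity
  have hs := Real.sq_sqrt hx0
  have h1 : (K / I.B * I.logKTd ^ 2) ^ 2 ≤ M * (K / I.B * I.logKTd) := by
    have h2 : K * I.logKTd ^ 3 / I.B ≤ M := (div_le_iff₀ hB).2 hM
    calc _ = K * I.logKTd ^ 3 / I.B * (K / I.B * I.logKTd) := by ring
      _ ≤ _ := mul_le_mul_of_nonneg_right h2 hx0
  have h3 : (K : ℝ) * I.logKTd / I.B = K / I.B * I.logKTd := by ring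
  rw [h3]
  unfold etaLP
  nlinarith [sq_nonneg (√(K / I.B * I.logKTd) - K / I.B * I.logKTd ^ 2)]

variable {I π}

theorem ncard_simpleRegret_le {β M γ ε : ℝ} (hβ : 0 < β) (hM : 0 < M) (hγ : 8 ≤ γ)
    (hB : β * I.T ≤ I.B) (hη : I.etaLP ≤ 1 / 2) (hπ : I.IsUcbBwK γ π) (h2 : 2 ≤ K * I.T * d)
    {ω : History K d I.T} (hc : ∀ t : Fin I.T, I.Confident (I.Crad γ) (past ω t))
    (hgap : ∀ m : Fin I.T, ∑ t : Fin I.T, radiusGap π (I.Crad γ)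
      (((m : ℕ) + 1 : ℕ) / (4 * I.T)) (past ω t, ω t) < 4 * I.logKTd)
    (hε : 0 < ε) (hε' : 2 * I.etaLP ≤ ε ∨ K * I.logKTd ^ 3 ≤ M * I.B) :
    (Set.ncard {t : Fin I.T | ε ≤ I.simpleRegret (π.choice (I.before ω t))} : ℝ) ≤
      (36864 * γ + 128 + 72 * (1 + M) / β) * (K / ε ^ 2) * I.logKTd := by
  have hT : (1 : ℝ) ≤ I.T := by exact_mod_cast I.T_pos
  have hK : (1 : ℝ) ≤ K := by exact_mod_cast I.null.pos
  have hBpos := I.B_pos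
  have hη0 := I.etaLP_nonneg
  have hL := I.lt_logKTd h2
  have hL0 := I.logKTd_nonneg
  have hcard : ∀ S : Set (Fin I.T), (S.ncard : ℝ) ≤ I.T := fun S => by
    exact_mod_cast (Set.ncard_le_card S).trans (by simp)
  have hMβ : 0 < 72 * (1 + M) / β := by positivity
  rcases lt_or_ge 1 ε with hε1 | hε1
  · have hempty : {t : Fin I.T | ε ≤ I.simpleRegret (π.choice (I.before ω t))} = ∅ := by
      refine Set.eq_empty_of_forall_notMem fun t ht => ?_
      exact absurd (I.simpleRegret_le_one π (I.before ω t)) (not_le.2 (hε1.trans_le ht))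
    rw [hempty, Set.ncard_empty]
    push_cast
    positivity
  -- Below `2 * etaLP` the claimed bound is at least `T`, by `etaLP_sq_le` and `β * T ≤ B`.
  rcases lt_or_ge ε (2 * I.etaLP) with hlt | hge
  · have hML := hε'.resolve_left (not_le.2 hlt)
    refine (hcard _).trans ?_
    have h3 : ε ^ 2 ≤ 72 * (1 + M) * (K * I.logKTd / I.B) := by
      have := I.etaLP_sq_le hML
      nlinarith
    have h4 : β * I.T * ε ^ 2 ≤ 72 * (1 + M) * (K * I.logKTd) := by
      refine (mul_le_mul hB h3 (sq_nonneg _) hBpos.le).trans (le_of_eq ?_)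
      field_simp
    have h5 : (I.T : ℝ) ≤ 72 * (1 + M) / β * (K / ε ^ 2) * I.logKTd := by
      have : 72 * (1 + M) / β * (K / ε ^ 2) * I.logKTd =
          72 * (1 + M) * (K * I.logKTd) / (β * ε ^ 2) := by
        field_simp
      rw [this, le_div_iff₀ (by positivity)]
      linarith
    refine h5.trans ?_
    gcongr
    linarith
  -- Below `1 / T` no grid threshold is available, but `T ≤ 1 / ε ^ 2` already.
  rcases lt_or_ge (ε * I.T) 1 with hsmall | hlarge
  · refine (hcard _).trans ?_
    have h3 : ε ^ 2 * I.T ≤ 1 := by nlinarith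
    have h4 : (I.T : ℝ) ≤ 1 / ε ^ 2 := by
      rw [le_div_iff₀ (by positivity)]
      linarith
    have h5 : 1 ≤ (36864 * γ + 128 + 72 * (1 + M) / β) * (K * I.logKTd) := by
      have h6 : 0.69 ≤ K * I.logKTd := by nlinarith
      have h7 : 2 ≤ 36864 * γ + 128 + 72 * (1 + M) / β := by linarith
      nlinarith
    calc (I.T : ℝ) ≤ 1 * (1 / ε ^ 2) := by linarith
      _ ≤ (36864 * γ + 128 + 72 * (1 + M) / β) * (K * I.logKTd) * (1 / ε ^ 2) := by gcongr
      _ = _ := by ring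
  set m := ⌊ε * I.T⌋₊ with hm
  have hm1 : 1 ≤ m := Nat.le_floor (by simpa using hlarge)
  have hmle : (m : ℝ) ≤ ε * I.T := Nat.floor_le (by positivity)
  have hmlt : ε * I.T < m + 1 := Nat.lt_floor_add_one _
  have hmT : m ≤ I.T := by
    have : (m : ℝ) ≤ I.T := hmle.trans (by nlinarith)
    exact_mod_cast this
  have hm1' : (1 : ℝ) ≤ m := by exact_mod_cast hm1
  -- The grid is indexed from 0, so index `m - 1` stands for the threshold `m / (4 * T)`. Since `m ≥
  -- 1`, `m + 1 ≤ 2 * m`, and rounding down loses at most a factor 2.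
  have hθ := hgap ⟨m - 1, by omega⟩
  simp only [Nat.sub_add_cancel hm1] at hθ
  set θ : ℝ := m / (4 * I.T) with hθdef
  have hθ1 : θ ≤ ε / 4 := by
    rw [hθdef, div_le_iff₀ (by positivity)]
    linarith
  have hθ2 : ε / 8 ≤ θ := by
    rw [hθdef, le_div_iff₀ (by positivity)]
    linarith
  have hC0 : 0 ≤ I.Crad γ := by
    unfold Crad
    positivity
  have hb := card_selected_mul_le π hC0 hθ
  have hsub : {t : Fin I.T | ε ≤ I.simpleRegret (π.choice (I.before ω t))} ⊆
      {t : Fin I.T | θ ≤ expRadius π (I.Crad γ) (past ω t)} := by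
    intro t ht
    have h3 : ε ≤ I.simpleRegret (π.choice (past ω t)) := ht
    have h4 : I.simpleRegret (π.choice (past ω t)) ≤ I.etaLP + 1 / I.B +
        expRadius π (I.Crad γ) (past ω t) :=
      I.simpleRegret_le_of_confident π (hπ t t.isLt _) (hc t) hη0 (by linarith) hC0
    have h5 := I.inv_budget_le_etaLP h2 hη
    change θ ≤ expRadius π (I.Crad γ) (past ω t)
    -- The expected radius is at least `ε - ε / 2 - ε / 24`, which exceeds `ε / 4 ≥ θ`.
    linarith
  have hle : (Set.ncard {t : Fin I.T | ε ≤ I.simpleRegret (π.choice (I.before ω t))} : ℝ) ≤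
      Set.ncard {t : Fin I.T | θ ≤ expRadius π (I.Crad γ) (past ω t)} := by
    exact_mod_cast Set.ncard_le_ncard hsub (Set.toFinite _)
  refine hle.trans ?_
  set s : ℝ := (Set.ncard {t : Fin I.T | θ ≤ expRadius π (I.Crad γ) (past ω t)} : ℝ) with hs
  have hs0 : 0 ≤ s := Nat.cast_nonneg _
  have h6 := le_of_quadratic_bound (a := I.Crad γ * K) hs0 hε hε1 (by positivity) hL0
    (by linarith [mul_le_mul_of_nonneg_left hθ2 hs0])
  refine h6.trans ?_
  have h7 : 36864 * (I.Crad γ * K) + 128 * I.logKTd ≤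
      (36864 * γ + 128 + 72 * (1 + M) / β) * (K * I.logKTd) := by
    unfold Crad
    have h8 : I.logKTd ≤ K * I.logKTd := le_mul_of_one_le_left hL0 hK
    have h9 : 0 ≤ 72 * (1 + M) / β * (K * I.logKTd) := by positivity
    linarith
  calc _ ≤ (36864 * γ + 128 + 72 * (1 + M) / β) * (K * I.logKTd) / ε ^ 2 := by gcongr
    _ = _ := by ring

variable (I π)

theorem law_concentration_fails_le {γ : ℝ} (hγ : 8 ≤ γ) (h2 : 2 ≤ K * I.T * d) :
    I.law π I.T {ω | ¬ ((∀ t : Fin I.T, I.Confident (I.Crad γ) (past ω t)) ∧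
      ∀ m : Fin I.T, ∑ t : Fin I.T, radiusGap π (I.Crad γ)
        (((m : ℕ) + 1 : ℕ) / (4 * I.T)) (past ω t, ω t) < 4 * I.logKTd)} ≤
      ENNReal.ofReal (5 / (I.T : ℝ) ^ 3) := by
  have hL := I.lt_logKTd h2
  have hC1 : 1 ≤ I.Crad γ := by
    unfold Crad
    nlinarith
  have hsub : {ω | ¬ ((∀ t : Fin I.T, I.Confident (I.Crad γ) (past ω t)) ∧
      ∀ m : Fin I.T, ∑ t : Fin I.T, radiusGap π (I.Crad γ)
        (((m : ℕ) + 1 : ℕ) / (4 * I.T)) (past ω t, ω t) < 4 * I.logKTd)} ⊆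
      {ω | ¬ ∀ t : Fin I.T, I.Confident (I.Crad γ) (past ω t)} ∪
      ⋃ m : Fin I.T, {ω | 4 * I.logKTd ≤ ∑ t : Fin I.T, radiusGap π (I.Crad γ)
        (((m : ℕ) + 1 : ℕ) / (4 * I.T)) (past ω t, ω t)} := by
    intro ω hω
    rcases not_and_or.1 hω with h | h
    · exact Or.inl h
    · obtain ⟨m, hm⟩ := not_forall.1 h
      exact Or.inr (Set.mem_iUnion.2 ⟨m, not_lt.1 hm⟩)
  -- Here `γ ≥ 8` enters: the Chernoff exponent `Crad / 2` is at least `4 * L`.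
  have hexp : ENNReal.ofReal (Real.exp (-(I.Crad γ / 2))) ≤
      ENNReal.ofReal (Real.exp (-(4 * I.logKTd))) := by
    refine ENNReal.ofReal_le_ofReal (Real.exp_le_exp.2 ?_)
    unfold Crad
    nlinarith
  have h1 := (I.law_not_confident_le π hC1 I.T).trans (mul_le_mul_right hexp _)
  have h3 : I.law π I.T (⋃ m : Fin I.T, {ω | 4 * I.logKTd ≤
      ∑ t : Fin I.T, radiusGap π (I.Crad γ)
        (((m : ℕ) + 1 : ℕ) / (4 * I.T)) (past ω t, ω t)}) ≤
      (I.T : ℕ) * ENNReal.ofReal (Real.exp (-(4 * I.logKTd))) := by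
    refine (measure_iUnion_fintype_le _ _).trans ?_
    refine (Finset.sum_le_sum fun m _ => I.law_radiusGap_tail_le π _ _ _ _).trans ?_
    simp
  refine (measure_mono hsub).trans ((measure_union_le _ _).trans ((add_le_add h1 h3).trans ?_))
  rw [← add_mul, ← Nat.cast_add, ← ENNReal.ofReal_natCast, ← ENNReal.ofReal_mul (Nat.cast_nonneg _),
    exp_neg_four_mul_logKTd]
  refine ENNReal.ofReal_le_ofReal ?_
  have hT : 0 < I.T := I.T_pos
  have hK : 0 < K := I.null.pos
  have hd : 0 < d := I.time.pos
  have h4 : (d + 1) * K * I.T * 2 + I.T ≤ 5 * (K * I.T * d) := by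
    have h5 : K * I.T ≤ K * I.T * d := Nat.le_mul_of_pos_right _ hd
    have h6 : I.T ≤ K * I.T := Nat.le_mul_of_pos_left _ hK
    linarith
  have h5 : I.T ≤ K * I.T * d :=
    (Nat.le_mul_of_pos_left _ hK).trans (Nat.le_mul_of_pos_right _ hd)
  have hP : (0 : ℝ) < (K * I.T * d : ℕ) := by exact_mod_cast I.prod_pos
  have hT' : (0 : ℝ) < I.T := by exact_mod_cast hT
  have h4' : (((d + 1) * K * I.T * 2 + I.T : ℕ) : ℝ) ≤ 5 * (K * I.T * d : ℕ) := by
    exact_mod_cast h4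
  have h5' : (I.T : ℝ) ≤ (K * I.T * d : ℕ) := by exact_mod_cast h5
  calc _ ≤ 5 * ((K * I.T * d : ℕ) : ℝ) * (1 / ((K * I.T * d : ℕ) : ℝ) ^ 4) :=
        mul_le_mul_of_nonneg_right h4' (by positivity)
    _ = 5 / ((K * I.T * d : ℕ) : ℝ) ^ 3 := by
        field_simp
    _ ≤ 5 / (I.T : ℝ) ^ 3 := by gcongr

end Instance

end BwK

theorem mainTheorem4 (β M γ : ℝ) (hβ : 0 < β) (hM : 0 < M) (hγ : 8 ≤ γ) :
    ∃ C : ℝ, 0 < C ∧ ∀ (K d : ℕ) (I : BwK.Instance K d) (π : BwK.Policy K d),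
      β * I.T ≤ I.B → I.etaLP ≤ 1 / 2 → I.IsUcbBwK γ π →
      I.law π I.T {ω | ¬ ∀ ε : ℝ, 0 < ε →
          (2 * I.etaLP ≤ ε ∨ K * I.logKTd ^ 3 ≤ M * I.B) →
          (Set.ncard {t : Fin I.T | ε ≤ I.simpleRegret (π.choice (I.before ω t))} : ℝ) ≤
            C * (K / ε ^ 2) * I.logKTd}
        ≤ ENNReal.ofReal (C / (I.T : ℝ) ^ 3) := by
  have hMβ : 0 < 72 * (1 + M) / β := by positivity
  have hC0 : 0 < 36864 * γ + 128 + 72 * (1 + M) / β := by linarith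
  refine ⟨36864 * γ + 128 + 72 * (1 + M) / β, hC0, fun K d I π hB hη hπ => ?_⟩
  -- If `K * T * d = 1` then `L = 0` and the claimed bound is 0; the null arm is the only arm, so no
  -- regret is positive.
  rcases lt_or_ge (K * I.T * d) 2 with h1 | h2
  · have hK : K = 1 := by
      have h3 : K * I.T * d = 1 := by have := I.prod_pos; omega
      exact Nat.eq_one_of_mul_eq_one_right (Nat.eq_one_of_mul_eq_one_right h3)
    refine le_of_eq_of_le ?_ zero_le
    convert measure_empty (μ := I.law π I.T)
    refine Set.eq_empty_of_forall_notMem fun ω hω => hω fun ε hε _ => ?_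
    have hempty : {t : Fin I.T | ε ≤ I.simpleRegret (π.choice (I.before ω t))} = ∅ := by
      refine Set.eq_empty_of_forall_notMem fun t ht => ?_
      exact absurd (I.simpleRegret_nonpos_of_unique hK π (I.before ω t))
        (not_le.2 (hε.trans_le ht))
    have hL := I.logKTd_nonneg
    rw [hempty, Set.ncard_empty, Nat.cast_zero]
    positivity
  · refine le_trans (measure_mono ?_)
      ((I.law_concentration_fails_le π hγ h2).trans (ENNReal.ofReal_le_ofReal ?_))
    · intro ω hω hgood
      refine hω fun ε hε hε' => ?_
      exact BwK.Instance.ncard_simpleRegret_le hβ hM hγ hB hη hπ h2 hgood.1 hgood.2 hε hε'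
    · gcongr
      linarith
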